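/- Let $I=\mathbb N=\{0,1,2,\dots\}$ or $I=\mathbb Z$, and let $a,b,c,\bar b,\bar c\in\mathbb R$ be such that $\lambda(x)=ax^2+bx+c$ and $\mu(x)=ax^2+\bar bx+\bar c$ satisfy: $\lambda(x)>0$ for all $x\in I$; if $I=\mathbb Z$, $\mu(x)>0$ for all $x\in I$; if $I=\mathbb N$, $\mu(0)=0$ and $\mu(x)>0$ for all $x\ge 1$. Let $\mathcal D$ be the matrix of transition rates on $I$ of the birth and death chain (reflecting at $0$ if $I=\mathbb N$, bilateral if $I=\mathbb Z$) with birth rates $\lambda(x)$ and death rates $\mu(x)$, and let $\tilde{\mathcal D}$ be the one with birth rates $\lambda(x+1)$ and death rates $\mu(x)$. Write $p_t(x,y)$, $\tilde p_t(x,y)$ for the transition probabilities of the continuous-time Markov chains with these rates. For $n\ge1$ let $W^n(I)=\{x\in I^n: x_1<\dots<x_n\}$, with the discrete topology, and $\Delta_n(x)=\prod_{1\le i<j\le n}(x_j-x_i)$. For $x\in W^{n+1}(I)$ let $W^{n,n+1}(x)$ be the (finite) set of all $y\in W^n(I)$ with $x_1\le y_1<x_2\le y_2<\dots\le y_n<x_{n+1}$,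 and define the Vandermonde link $$(\mathfrak L_{n\to n+1}f)(x)=\frac{n!}{\Delta_{n+1}(x)}\sum_{y\in W^{n,n+1}(x)}\Delta_n(y)f(y),\qquad x\in W^{n+1}(I).$$ Let $P_n(t)$ and $\tilde P_n(t)$ be the Karlin--McGregor semigroups on $W^n(I)$, with kernels $\det(p_t(x_i,y_j))_{i,j=1}^n$ and $\det(\tilde p_t(x_i,y_j))_{i,j=1}^n$. Put $\kappa_n=a\frac{n(n-1)(n-2)}3+(b-\bar b)\frac{n(n-1)}2$ and $\tilde\kappa_n=a\frac{n(n-1)(n-2)}3+(b+2a-\bar b)\frac{n(n-1)}2$. Then for every $n\ge1$, $\Delta_{n+1}$ is a strictly positive eigenfunction of $P_{n+1}(t)$ with eigenvalue $e^{\kappa_{n+1}t}$, and $\Delta_n$ is a strictly positive eigenfunction of $\tilde P_n(t)$ with eigenvalue $e^{\tilde\kappa_nt}$, for all $t\ge0$. The Doob transforms $P^{\Delta_{n+1}}_{n+1}(t)=e^{-\kappa_{n+1}t}\Delta_{n+1}^{-1}\circ P_{n+1}(t)\circ\Delta_{n+1}$ and $\tilde P^{\Delta_n}_n(t)=e^{-\tilde\kappa_nt}\Delta_n^{-1}\circ\tilde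 P_n(t)\circ\Delta_n$ satisfy, for every real-valued $f\in C_0(W^n(I))$ (functions vanishing at infinity) and every $t\ge0$, $$P^{\Delta_{n+1}}_{n+1}(t)\,\mathfrak L_{n\to n+1}f=\mathfrak L_{n\to n+1}\,\tilde P^{\Delta_n}_n(t)f ,$$ where the series that define the two semigroups applied to $\mathfrak L_{n\to n+1}f$ and to $f$ converge absolutely. -/

import Mathlib

open scoped ENNReal

noncomputable section

/-- Transition probabilities of the continuous-time Markov chain on the countable set `E` with
matrix of transition rates `Q` (`Q x z` for `z ≠ x` is the rate of the jump from `x` to `z`, and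
`-Q x x` is the total rate of leaving `x`), restricted to fewer than `k` jumps:
`jumpTransition Q k t x y = ℙ_x (X t = y and X makes fewer than k jumps up to time t)`.
The recursion conditions on the time `s` and the target `z` of the first jump. -/
def jumpTransition {E : Type*} (Q : Matrix E E ℝ) : ℕ → ℝ → E → E → ℝ≥0∞
  | 0, _, _, _ => 0
  | k + 1, t, x, y =>
      (open Classical in if x = y then ENNReal.ofReal (Real.exp (Q x x * t)) else 0) +
        ∫⁻ s in Set.Icc (0 : ℝ) t, ENNReal.ofReal (Real.exp (Q x x * s)) *
          ∑' z : {z : E // z ≠ x}, ENNReal.ofReal (Q x z) * jumpTransition Q k (t - s) z y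

/-- The transition density `p_t(x,y) = ℙ_x (X t = y)` of the Markov chain with matrix of
transition rates `Q`, the increasing limit of the transition probabilities with fewer than `k`
jumps (Feller's minimal solution of the Kolmogorov backward equation; the only solution
when the chain does not explode). -/
def transitionDensity {E : Type*} (Q : Matrix E E ℝ) (t : ℝ) (x y : E) : ℝ :=
  (⨆ k : ℕ, jumpTransition Q k t x y).toReal

/-- The matrix of transition rates of the birth and death chain on `I ⊆ ℤ` with birth rates `lam`
and death rates `mu`. -/
def birthDeathMatrix (I : Set ℤ) (lam mu : ℤ → ℝ) : Matrix I I ℝ := fun x y =>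
  if (y : ℤ) = x + 1 then lam x
  else if (y : ℤ) = x then -lam x - mu x
  else if (y : ℤ) = x - 1 then mu x
  else 0

/-- The discrete Weyl chamber `W^n(I) = {x ∈ I^n : x_1 < ⋯ < x_n}`, with its discrete topology. -/
abbrev WeylChamber (I : Set ℤ) (n : ℕ) : Type := {x : Fin n → I // StrictMono x}

/-- `y ∈ W^{n,n+1}(x)`, i.e. `x_1 ≤ y_1 < x_2 ≤ y_2 < ⋯ ≤ y_n < x_{n+1}`. -/
def Interlaces {I : Set ℤ} {n : ℕ} (x : WeylChamber I (n + 1)) (y : WeylChamber I n) : Prop :=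
  ∀ i : Fin n, x.1 i.castSucc ≤ y.1 i ∧ y.1 i < x.1 i.succ

/-- The Vandermonde determinant `Δ_n(x) = ∏_{i < j} (x_j - x_i)`. -/
def vdm {I : Set ℤ} {n : ℕ} (x : WeylChamber I n) : ℝ :=
  ∏ i : Fin n, ∏ j ∈ Finset.Ioi i, (((x.1 j : ℤ) : ℝ) - ((x.1 i : ℤ) : ℝ))

/-- The kernel `det (p_t(x_i, y_j))` on `W^n(I)` of the Karlin–McGregor semigroup of `n` copies of
the chain on `I` with matrix of transition rates `Q`. -/
def karlinMcGregor {I : Set ℤ} (Q : Matrix I I ℝ) (n : ℕ) (t : ℝ) (x y : WeylChamber I n) : ℝ :=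
  Matrix.det (Matrix.of fun i j : Fin n => transitionDensity Q t (x.1 i) (y.1 j))

/-- `h` is a strictly positive eigenfunction, with eigenvalues `e^{κ t}`, of the semigroup with
kernels `P t`. -/
def IsPositiveEigenfunction {E : Type*} (P : ℝ → E → E → ℝ) (h : E → ℝ) (κ : ℝ) : Prop :=
  (∀ x, 0 < h x) ∧
    ∀ t : ℝ, 0 ≤ t → ∀ x, HasSum (fun y => P t x y * h y) (Real.exp (κ * t) * h x)

/-- Doob's transform `e^{-κ t} h⁻¹ ∘ P(t) ∘ h` by an eigenfunction `h` with eigenvalues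
`e^{κ t}`. -/
def doobTransform {E : Type*} (P : ℝ → E → E → ℝ) (h : E → ℝ) (κ t : ℝ) (f : E → ℝ) (x : E) : ℝ :=
  Real.exp (-κ * t) * (h x)⁻¹ * ∑' y, P t x y * (h y * f y)

/-- The Vandermonde link from `W^{n+1}(I)` to `W^n(I)`,
`(𝔏 f)(x) = (n! / Δ_{n+1}(x)) ∑_{y ∈ W^{n,n+1}(x)} Δ_n(y) f(y)`; the sum is finite. -/
def vandermondeLink {I : Set ℤ} {n : ℕ} (f : WeylChamber I n → ℝ) (x : WeylChamber I (n + 1)) : ℝ :=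
  (n.factorial : ℝ) / vdm x * ∑' y : {y : WeylChamber I n // Interlaces x y}, vdm y.1 * f y.1

/-- The quadratic rate `a x² + b x + c`. -/
def quadRate (a b c : ℝ) (x : ℤ) : ℝ := a * (x : ℝ) ^ 2 + b * (x : ℝ) + c

/-- The eigenvalue `a n(n-1)(n-2)/3 + (b - b') n(n-1)/2` of the sum of `n` copies of the
birth and death generator with rates `a x² + b x + c` and `a x² + b' x + c'` on `Δ_n`. -/
def vdmEigenvalue (a b b' : ℝ) (n : ℕ) : ℝ :=
  a * ((n : ℝ) * (n - 1) * (n - 2) / 3) + (b - b') * ((n : ℝ) * (n - 1) / 2)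

end

/-! The argument has three ingredients: a duality for one particle, a determinantal description of
interlacing, and the triangular action of the generator on polynomials.

Duality. Let `F_t(x)` be the probability that the chain with rates `λ(x), μ(x)` started at `x` lies
above `y` at time `t`, and let `D_t(x) = F_t(x+1) - F_t(x)`. Differencing the backward equation
shows that `D` solves the backward equation of the chain with rates `λ(x+1), μ(x)`, up to the
zeroth-order factor `r = λ(x+1) - λ(x) - μ(x+1) + μ(x)`. Since the two rates share the coefficient
`a`, `r = b - b'` is constant, so `D_t(x)` is `e^{rt}` times the transition probability of the
shifted chain (`tail_transitionSemigroup_sub`).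

Interlacing. The indicator of `y` interlacing with `x` is the determinant of size `n + 1` with rows
`(1, 1{x_i > y_1}, …, 1{x_i > y_n})`. By Andréief's identity the Karlin–McGregor kernel carries it
to the determinant with rows `(1, F^{(1)}_t(x_i), …, F^{(n)}_t(x_i))`. Subtracting consecutive rows
and applying the duality gives `e^{rnt}` times the sum of the shifted kernel over the points
interlacing with `x` (`hasSum_karlinMcGregor_interlaces`). Integrating against `Δ_n f` yields the
intertwining, and `κ_{n+1} = κ̃_n + rn` makes the exponential factors cancel.

Eigenfunctions. The generator does not raise the degree of polynomials, so on degree less than `n`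
the semigroup is `exp(tA)` with `A` triangular. Andréief's identity applied to monomials multiplies
the Vandermonde determinant by `det exp(tA) = e^{t tr A}` (`hasSum_karlinMcGregor_mul_vdm`).

All identities for one particle reduce to uniqueness for the backward equation among functions of
polynomial growth (`IsBackwardSolution.eq_of_initial_eq`), a maximum principle with the Lyapunov
functions `1 + x^{2k}`. The same functions bound all moments and justify every exchange of sums. -/

open MeasureTheory Set Filter Topology

/-! ### Minimal semigroup of a jump chain: integral backward equation and Lyapunov bound. -/

section JumpChain

theorem measurable_lintegral_Icc_conv {f g : ℝ → ℝ≥0∞} (hf : Measurable f) (hg : Measurable g) :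
    Measurable fun t : ℝ => ∫⁻ s in Icc (0 : ℝ) t, f s * g (t - s) := by
  have hS : MeasurableSet {p : ℝ × ℝ | 0 ≤ p.2 ∧ p.2 ≤ p.1} :=
    (measurableSet_le measurable_const measurable_snd).inter
      (measurableSet_le measurable_snd measurable_fst)
  have hm : Measurable ({p : ℝ × ℝ | 0 ≤ p.2 ∧ p.2 ≤ p.1}.indicator
      fun p => f p.2 * g (p.1 - p.2)) :=
    ((hf.comp measurable_snd).mul (hg.comp (measurable_fst.sub measurable_snd))).indicator hS
  have h := hm.lintegral_prod_right' (ν := (volume : Measure ℝ))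
  convert h using 2 with t
  rw [← lintegral_indicator measurableSet_Icc]
  refine lintegral_congr fun s => ?_
  simp only [indicator, mem_Icc, mem_ofPred_eq]

/-- Reversing time puts all dependence on `t` into the exponential factor, so that the backward
equation becomes a formula with a primitive in `t`. -/
theorem lintegral_Icc_conv_comm (f g : ℝ → ℝ≥0∞) (t : ℝ) :
    ∫⁻ s in Icc (0 : ℝ) t, f s * g (t - s) = ∫⁻ s in Icc (0 : ℝ) t, f (t - s) * g s := by
  rw [← lintegral_indicator measurableSet_Icc, ← lintegral_indicator measurableSet_Icc,
    ← lintegral_sub_left_eq_self _ t]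
  refine lintegral_congr fun s => ?_
  simp only [indicator, mem_Icc, sub_nonneg, sub_sub_cancel]
  refine if_congr ?_ rfl rfl
  constructor <;> rintro ⟨h1, h2⟩ <;> constructor <;> linarith

/-- Monotone convergence for the counting measure. -/
theorem ENNReal.tsum_iSup_of_monotone {α : Type*} {f : ℕ → α → ℝ≥0∞} (hf : Monotone f) :
    ∑' a, ⨆ k, f k a = ⨆ k, ∑' a, f k a := by
  let _ : MeasurableSpace α := ⊤
  simp only [← lintegral_count]
  exact lintegral_iSup (fun _ => measurable_from_top) hf

variable {E : Type*} (Q : Matrix E E ℝ)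

theorem measurable_jumpTransition [Countable E] (k : ℕ) (x y : E) :
    Measurable fun t => jumpTransition Q k t x y := by
  induction k generalizing x with
  | zero => exact measurable_const
  | succ k ih =>
    simp only [jumpTransition]
    refine Measurable.add ?_ (measurable_lintegral_Icc_conv
      (f := fun s => ENNReal.ofReal (Real.exp (Q x x * s)))
      (g := fun s => ∑' z : {z : E // z ≠ x}, ENNReal.ofReal (Q x z) * jumpTransition Q k s z y)
      (by fun_prop) (Measurable.tsum fun z => (ih z).const_mul _))
    split_ifs
    · fun_prop
    · exact measurable_const

theorem monotone_jumpTransition (t : ℝ) (x y : E) :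
    Monotone fun k => jumpTransition Q k t x y := by
  refine monotone_nat_of_le_succ fun k => ?_
  induction k generalizing t x with
  | zero => exact zero_le
  | succ k ih =>
    simp only [jumpTransition]
    gcongr
    exact ih _ _

/-- The action of the chain killed at its `k`-th jump on nonnegative functions. -/
noncomputable def jumpSemigroup (k : ℕ) (h : E → ℝ≥0∞) (t : ℝ) (x : E) : ℝ≥0∞ :=
  ∑' y, jumpTransition Q k t x y * h y

/-- The action of the minimal semigroup on nonnegative functions. -/
noncomputable def minimalSemigroup (h : E → ℝ≥0∞) (t : ℝ) (x : E) : ℝ≥0∞ :=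
  ∑' y, (⨆ k, jumpTransition Q k t x y) * h y

theorem monotone_jumpSemigroup (h : E → ℝ≥0∞) (t : ℝ) (x : E) :
    Monotone fun k => jumpSemigroup Q k h t x := fun _ _ hkl =>
  ENNReal.tsum_le_tsum fun y => mul_le_mul_left (monotone_jumpTransition Q t x y hkl) _

theorem minimalSemigroup_eq_iSup (h : E → ℝ≥0∞) (t : ℝ) (x : E) :
    minimalSemigroup Q h t x = ⨆ k, jumpSemigroup Q k h t x := by
  simp only [minimalSemigroup, jumpSemigroup, ENNReal.iSup_mul]
  exact ENNReal.tsum_iSup_of_monotone fun _ _ hkl y =>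
    mul_le_mul_left (monotone_jumpTransition Q t x y hkl) _

variable [Countable E]

theorem measurable_jumpSemigroup (k : ℕ) (h : E → ℝ≥0∞) (x : E) :
    Measurable fun t => jumpSemigroup Q k h t x :=
  Measurable.tsum fun y => (measurable_jumpTransition Q k x y).mul_const _

theorem measurable_minimalSemigroup (h : E → ℝ≥0∞) (x : E) :
    Measurable fun t => minimalSemigroup Q h t x :=
  Measurable.tsum fun y =>
    (Measurable.iSup fun k => measurable_jumpTransition Q k x y).mul_const _

theorem jumpSemigroup_succ (k : ℕ) (h : E → ℝ≥0∞) (t : ℝ) (x : E) :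
    jumpSemigroup Q (k + 1) h t x = ENNReal.ofReal (Real.exp (Q x x * t)) * h x +
      ∫⁻ s in Icc (0 : ℝ) t, ENNReal.ofReal (Real.exp (Q x x * s)) *
        ∑' z : {z : E // z ≠ x}, ENNReal.ofReal (Q x z) * jumpSemigroup Q k h (t - s) z := by
  classical
  simp only [jumpSemigroup, jumpTransition, add_mul]
  rw [ENNReal.tsum_add]
  congr 1
  · rw [tsum_eq_single x]
    · simp
    · intro y hy
      simp [Ne.symm hy]
  · have hmeas : ∀ y : E, Measurable fun s => ENNReal.ofReal (Real.exp (Q x x * s)) *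
        ∑' z : {z : E // z ≠ x}, ENNReal.ofReal (Q x z) * jumpTransition Q k (t - s) z y := by
      intro y
      refine Measurable.mul (by fun_prop) (Measurable.tsum fun z => ?_)
      exact ((measurable_jumpTransition Q k z y).comp (measurable_const.sub measurable_id)).const_mul _
    simp_rw [← lintegral_mul_const _ (hmeas _)]
    rw [← lintegral_tsum fun y => ((hmeas y).mul_const _).aemeasurable]
    refine lintegral_congr fun s => ?_
    simp_rw [mul_assoc, ENNReal.tsum_mul_left, ← ENNReal.tsum_mul_left, ← ENNReal.tsum_mul_right]
    rw [ENNReal.tsum_comm]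
    simp only [ENNReal.tsum_mul_left, mul_assoc]

/-- The first-jump recursion passes to the limit of infinitely many jumps by monotone convergence,
in the sum and in the integral. -/
theorem minimalSemigroup_eq (h : E → ℝ≥0∞) (t : ℝ) (x : E) :
    minimalSemigroup Q h t x = ENNReal.ofReal (Real.exp (Q x x * t)) * h x +
      ∫⁻ s in Icc (0 : ℝ) t, ENNReal.ofReal (Real.exp (Q x x * s)) *
        ∑' z : {z : E // z ≠ x}, ENNReal.ofReal (Q x z) * minimalSemigroup Q h (t - s) z := by
  have hmono := monotone_jumpSemigroup Q h
  have h1 : minimalSemigroup Q h t x = ⨆ k, jumpSemigroup Q (k + 1) h t x := by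
    rw [minimalSemigroup_eq_iSup, (hmono t x).iSup_nat_add 1]
  rw [h1]
  simp only [jumpSemigroup_succ, minimalSemigroup_eq_iSup, ENNReal.mul_iSup]
  have hm2 : ∀ s, Monotone fun (k : ℕ) (z : {z : E // z ≠ x}) =>
      ENNReal.ofReal (Q x z) * jumpSemigroup Q k h (t - s) z := fun s k l hkl z =>
    mul_le_mul_right (hmono _ _ hkl) _
  rw [← ENNReal.add_iSup]
  congr 1
  rw [← lintegral_iSup]
  · refine lintegral_congr fun s => ?_
    rw [ENNReal.tsum_iSup_of_monotone (hm2 s), ENNReal.mul_iSup]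
  · intro k
    refine Measurable.mul (by fun_prop) (Measurable.tsum fun z => ?_)
    exact ((measurable_jumpSemigroup Q k h z).comp (measurable_const.sub measurable_id)).const_mul _
  · intro k l hkl s
    exact mul_le_mul_right (ENNReal.tsum_le_tsum fun z => hm2 s hkl z) _

/-- The hypothesis says `Q V ≤ C V`. The bound holds for each number of jumps by induction on the
first-jump recursion, and `e^{Ct} V` reproduces itself there because the integral of `e^{qs}
e^{C(t-s)} (C - q)` is exactly `e^{Ct} - e^{qt}`. -/
theorem minimalSemigroup_le {V : E → ℝ≥0∞} {C : ℝ} (hC : ∀ x, Q x x < C)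
    (hV : ∀ x, ∑' z : {z : E // z ≠ x}, ENNReal.ofReal (Q x z) * V z ≤
      ENNReal.ofReal (C - Q x x) * V x) {t : ℝ} (ht : 0 ≤ t) (x : E) :
    minimalSemigroup Q V t x ≤ ENNReal.ofReal (Real.exp (C * t)) * V x := by
  rw [minimalSemigroup_eq_iSup]
  refine iSup_le fun k => ?_
  induction k generalizing t x with
  | zero => simp [jumpSemigroup, jumpTransition]
  | succ k ih =>
    rw [jumpSemigroup_succ]
    set q := Q x x
    have hint : ∫⁻ s in Icc (0 : ℝ) t, ENNReal.ofReal (Real.exp (q * s)) *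
          (ENNReal.ofReal (Real.exp (C * (t - s))) * ENNReal.ofReal (C - q)) =
        ENNReal.ofReal (Real.exp (C * t) - Real.exp (q * t)) := by
      have hd : ∀ s ∈ uIcc 0 t, HasDerivAt (fun s => -Real.exp (q * s + C * (t - s)))
          (Real.exp (q * s) * (Real.exp (C * (t - s)) * (C - q))) s := by
        intro s _
        have h1 : HasDerivAt (fun s => q * s + C * (t - s)) (q - C) s := by
          have := ((hasDerivAt_id s).const_mul q).add
            (((hasDerivAt_const s t).sub (hasDerivAt_id s)).const_mul C)
          exact this.congr_deriv (by ring)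
        refine h1.exp.neg.congr_deriv ?_
        rw [Real.exp_add]
        ring
      have hI := intervalIntegral.integral_eq_sub_of_hasDerivAt hd
        (Continuous.intervalIntegrable (by fun_prop) _ _)
      simp only [sub_self, mul_zero, add_zero, sub_zero, zero_add] at hI
      rw [intervalIntegral.integral_of_le ht, ← integral_Icc_eq_integral_Ioc] at hI
      rw [show Real.exp (C * t) - Real.exp (q * t) = -Real.exp (q * t) - -Real.exp (C * t) by ring,
        ← hI, ofReal_integral_eq_lintegral_ofReal]
      · refine lintegral_congr fun s => ?_
        rw [ENNReal.ofReal_mul (Real.exp_pos _).le, ENNReal.ofReal_mul (Real.exp_pos _).le]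
      · exact (Continuous.integrableOn_Icc (by fun_prop))
      · refine ae_of_all _ fun s => ?_
        have := sub_pos.2 (hC x)
        positivity
    calc _ ≤ ENNReal.ofReal (Real.exp (q * t)) * V x +
        ∫⁻ s in Icc (0 : ℝ) t, (ENNReal.ofReal (Real.exp (q * s)) *
          (ENNReal.ofReal (Real.exp (C * (t - s))) * ENNReal.ofReal (C - q))) * V x := by
          refine add_le_add le_rfl ?_
          refine setLIntegral_mono' measurableSet_Icc fun s hs => ?_
          rw [mul_assoc, mul_assoc]
          gcongr
          calc _ ≤ ∑' z : {z : E // z ≠ x}, ENNReal.ofReal (Real.exp (C * (t - s))) *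
                (ENNReal.ofReal (Q x z) * V z) := by
                refine ENNReal.tsum_le_tsum fun z => ?_
                rw [mul_left_comm]
                gcongr
                exact ih (sub_nonneg.2 hs.2) _
            _ ≤ _ := by
                rw [ENNReal.tsum_mul_left]
                gcongr
                exact hV x
      _ = _ := by
          rw [lintegral_mul_const _ (by fun_prop), hint, ← add_mul,
            ← ENNReal.ofReal_add (Real.exp_pos _).le]
          · congr 2
            ring
          · have : q * t ≤ C * t := mul_le_mul_of_nonneg_right (hC x).le ht
            linarith [Real.exp_le_exp.2 this]

end JumpChain

/-! ### Backward equation of a birth and death chain: maximum principle and uniqueness. -/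

section BirthDeath

variable {I : Set ℤ}

open Classical in
/-- The right neighbour of `x` in `I`, or `x` itself if `x + 1 ∉ I`. -/
noncomputable def upNeighbor (x : I) : I :=
  if h : (x : ℤ) + 1 ∈ I then ⟨x + 1, h⟩ else x

open Classical in
/-- The left neighbour of `x` in `I`, or `x` itself if `x - 1 ∉ I`. -/
noncomputable def downNeighbor (x : I) : I :=
  if h : (x : ℤ) - 1 ∈ I then ⟨x - 1, h⟩ else x

/-- The birth and death generator acting on functions. -/
noncomputable def birthDeathGen (lam mu : ℤ → ℝ) (u : I → ℝ) (x : I) : ℝ :=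
  lam x * (u (upNeighbor x) - u x) + mu x * (u (downNeighbor x) - u x)

/-- The polynomial weights `1 + x ^ (2 k)`. -/
noncomputable def polyWeight (k : ℕ) (x : I) : ℝ := 1 + ((x : ℤ) : ℝ) ^ (2 * k)

theorem one_le_polyWeight (k : ℕ) (x : I) : 1 ≤ polyWeight k x := by
  have := (even_two_mul k).pow_nonneg ((x : ℤ) : ℝ)
  unfold polyWeight
  linarith

theorem polyWeight_pos (k : ℕ) (x : I) : 0 < polyWeight k x :=
  zero_lt_one.trans_le (one_le_polyWeight k x)

/-- Birth and death rates on a set closed under `x ↦ x + 1`, for which the polynomial weights are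
Lyapunov functions. -/
structure PolyBirthDeath (I : Set ℤ) (lam mu : ℤ → ℝ) : Prop where
  succ_mem : ∀ x ∈ I, x + 1 ∈ I
  pred_mem : ∀ x ∈ I, mu x ≠ 0 → x - 1 ∈ I
  lam_nonneg : ∀ x ∈ I, 0 ≤ lam x
  mu_nonneg : ∀ x ∈ I, 0 ≤ mu x
  lyapunov : ∀ k, ∃ C, ∀ x : I, birthDeathGen lam mu (polyWeight k) x ≤ C * polyWeight k x

/-- Solutions of polynomial growth of the Kolmogorov backward equation. -/
structure IsBackwardSolution (lam mu : ℤ → ℝ) (u : ℝ → I → ℝ) : Prop where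
  continuousOn : ∀ x, ContinuousOn (fun t => u t x) (Ici 0)
  hasDerivAt : ∀ x t, 0 < t → HasDerivAt (fun t => u t x) (birthDeathGen lam mu (u t) x) t
  growth : ∀ T, ∃ k M, ∀ t ∈ Icc 0 T, ∀ x, |u t x| ≤ M * polyWeight k x

theorem polyWeight_le_two_mul {k l : ℕ} (hkl : k ≤ l) (x : I) :
    polyWeight k x ≤ 2 * polyWeight l x := by
  unfold polyWeight
  simp only [pow_mul]
  set r := ((x : ℤ) : ℝ) ^ 2
  have hr : 0 ≤ r := sq_nonneg _
  have h0 : 0 ≤ r ^ l := by positivity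
  rcases le_total r 1 with h | h
  · linarith [pow_le_one₀ hr h (n := k)]
  · linarith [pow_le_pow_right₀ h hkl]

theorem growth_add {f g : I → ℝ} {k l : ℕ} {M N : ℝ}
    {x : I} (hf : |f x| ≤ M * polyWeight k x) (hg : |g x| ≤ N * polyWeight l x) :
    |f x + g x| ≤ (2 * |M| + 2 * |N|) * polyWeight (max k l) x := by
  have h1 := polyWeight_le_two_mul (le_max_left k l) x
  have h2 := polyWeight_le_two_mul (le_max_right k l) x
  have h3 : M * polyWeight k x ≤ |M| * polyWeight k x :=
    mul_le_mul_of_nonneg_right (le_abs_self M) (polyWeight_pos k x).le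
  have h4 : N * polyWeight l x ≤ |N| * polyWeight l x :=
    mul_le_mul_of_nonneg_right (le_abs_self N) (polyWeight_pos l x).le
  have h5 := mul_le_mul_of_nonneg_left h1 (abs_nonneg M)
  have h6 := mul_le_mul_of_nonneg_left h2 (abs_nonneg N)
  have := abs_add_le (f x) (g x)
  linarith

variable {lam mu : ℤ → ℝ}

theorem birthDeathGen_add (f g : I → ℝ) (x : I) :
    birthDeathGen lam mu (fun y => f y + g y) x =
      birthDeathGen lam mu f x + birthDeathGen lam mu g x := by
  unfold birthDeathGen
  ring

theorem birthDeathGen_const_mul (r : ℝ) (f : I → ℝ) (x : I) :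
    birthDeathGen lam mu (fun y => r * f y) x = r * birthDeathGen lam mu f x := by
  unfold birthDeathGen
  ring

theorem birthDeathGen_sum {ι : Type*} (s : Finset ι) (f : ι → I → ℝ) (x : I) :
    birthDeathGen lam mu (fun y => ∑ i ∈ s, f i y) x = ∑ i ∈ s, birthDeathGen lam mu (f i) x := by
  unfold birthDeathGen
  rw [Finset.sum_add_distrib, ← Finset.mul_sum, ← Finset.mul_sum, Finset.sum_sub_distrib,
    Finset.sum_sub_distrib]

namespace IsBackwardSolution

variable {u v : ℝ → I → ℝ}

theorem add (hu : IsBackwardSolution lam mu u) (hv : IsBackwardSolution lam mu v) :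
    IsBackwardSolution lam mu fun t x => u t x + v t x where
  continuousOn x := (hu.continuousOn x).add (hv.continuousOn x)
  hasDerivAt x t ht := ((hu.hasDerivAt x t ht).add (hv.hasDerivAt x t ht)).congr_deriv
    (birthDeathGen_add _ _ _).symm
  growth T := by
    obtain ⟨k, M, h⟩ := hu.growth T
    obtain ⟨l, N, h'⟩ := hv.growth T
    exact ⟨_, _, fun t ht x => growth_add (h t ht x) (h' t ht x)⟩

theorem const_mul (r : ℝ) (hu : IsBackwardSolution lam mu u) :
    IsBackwardSolution lam mu fun t x => r * u t x where
  continuousOn x := continuousOn_const.mul (hu.continuousOn x)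
  hasDerivAt x t ht := ((hu.hasDerivAt x t ht).const_mul r).congr_deriv
    (birthDeathGen_const_mul _ _ _).symm
  growth T := by
    obtain ⟨k, M, h⟩ := hu.growth T
    refine ⟨k, |r| * M, fun t ht x => ?_⟩
    rw [abs_mul, mul_assoc]
    exact mul_le_mul_of_nonneg_left (h t ht x) (abs_nonneg r)

theorem sub (hu : IsBackwardSolution lam mu u) (hv : IsBackwardSolution lam mu v) :
    IsBackwardSolution lam mu fun t x => u t x - v t x := by
  simpa [sub_eq_add_neg] using hu.add (hv.const_mul (-1))

/-- For `|y| > 2|M|/ε + 1` one has `M (1 + y^{2k}) ≤ 2|M| y^{2k} < ε y^{2k+2}`, so only boundedly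
many integers remain. -/
theorem finite_polyWeight_le {ε M : ℝ} (hε : 0 < ε) (k : ℕ) :
    {x : I | ε * polyWeight (k + 1) x ≤ M * polyWeight k x}.Finite := by
  have hfin : ((fun x : I => (x : ℤ)) ⁻¹' Icc (-⌈2 * |M| / ε + 1⌉) ⌈2 * |M| / ε + 1⌉).Finite :=
    (finite_Icc _ _).preimage Subtype.val_injective.injOn
  refine hfin.subset fun x hx => ?_
  simp only [mem_ofPred_eq, polyWeight, pow_mul] at hx
  set y := ((x : ℤ) : ℝ) with hy
  set R := 2 * |M| / ε + 1 with hR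
  have hR1 : 1 ≤ R := by
    have : 0 ≤ 2 * |M| / ε := by positivity
    linarith
  have hyR : |y| ≤ R := by
    by_contra! hlt
    have hy1 : 1 < |y| := hR1.trans_lt hlt
    have hy2 : |y| ≤ y ^ 2 := by
      rw [← sq_abs]
      nlinarith
    have hp : 1 ≤ (y ^ 2) ^ k := one_le_pow₀ (by linarith)
    have h1 : 2 * |M| < ε * |y| := by
      have : 2 * |M| / ε < |y| := by linarith
      rw [div_lt_iff₀ hε] at this
      linarith
    have h2 : M * (1 + (y ^ 2) ^ k) ≤ |M| * (2 * (y ^ 2) ^ k) :=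
      mul_le_mul (le_abs_self M) (by linarith) (by positivity) (abs_nonneg M)
    have h3 : 2 * |M| < ε * y ^ 2 := h1.trans_le (mul_le_mul_of_nonneg_left hy2 hε.le)
    have h4 : 2 * |M| * (y ^ 2) ^ k < ε * y ^ 2 * (y ^ 2) ^ k :=
      mul_lt_mul_of_pos_right h3 (by linarith)
    rw [pow_succ] at hx
    linarith
  rw [abs_le] at hyR
  have := Int.le_ceil R
  simp only [mem_preimage, mem_Icc]
  constructor
  · have : ((-⌈R⌉ : ℤ) : ℝ) ≤ y := by push_cast; linarith
    rw [hy] at this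
    exact_mod_cast this
  · have : y ≤ ((⌈R⌉ : ℤ) : ℝ) := by linarith
    rw [hy] at this
    exact_mod_cast this

/-- The maximum principle for the backward equation. -/
theorem nonneg (hP : PolyBirthDeath I lam mu) (hu : IsBackwardSolution lam mu u)
    (h0 : ∀ x, 0 ≤ u 0 x) {t : ℝ} (ht : 0 ≤ t) (x : I) : 0 ≤ u t x := by
  obtain ⟨k, M, hM⟩ := hu.growth t
  -- A weight one order above the growth of `u` makes the perturbation dominate outside a finite
  -- set; taking `K > C` makes it a strict supersolution.
  obtain ⟨C, hC⟩ := hP.lyapunov (k + 1)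
  set K := |C| + 1
  have hCK : C < K := by linarith [le_abs_self C]
  have hK0 : 0 ≤ K := by positivity
  suffices h : ∀ ε : ℝ, 0 < ε → 0 ≤ u t x + ε * (Real.exp (K * t) * polyWeight (k + 1) x) by
    refine le_of_forall_pos_le_add fun δ hδ => ?_
    have hpos : 0 < Real.exp (K * t) * polyWeight (k + 1) x :=
      mul_pos (Real.exp_pos _) (polyWeight_pos _ _)
    have := h (δ / (Real.exp (K * t) * polyWeight (k + 1) x)) (by positivity)
    rwa [div_mul_cancel₀ _ hpos.ne'] at this
  intro ε hε
  set v : ℝ → I → ℝ := fun s y => u s y + ε * (Real.exp (K * s) * polyWeight (k + 1) y) with hv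
  change 0 ≤ v t x
  by_contra! hneg
  set S := (finite_polyWeight_le (I := I) (M := M) hε k).toFinset
  have hout : ∀ s ∈ Icc 0 t, ∀ y ∉ S, 0 ≤ v s y := by
    intro s hs y hy
    simp only [S, Finite.mem_toFinset, mem_ofPred_eq, not_le] at hy
    have h1 := (abs_le.1 (hM s hs y)).1
    have h2 : polyWeight (k + 1) y ≤ Real.exp (K * s) * polyWeight (k + 1) y :=
      le_mul_of_one_le_left (polyWeight_pos _ _).le (Real.one_le_exp (mul_nonneg hK0 hs.1))
    have h3 := mul_le_mul_of_nonneg_left h2 hε.le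
    simp only [hv]
    linarith
  have hcont : ∀ y, ContinuousOn (fun s => v s y) (Icc 0 t) := fun y =>
    ((hu.continuousOn y).mono Icc_subset_Ici_self).add (Continuous.continuousOn (by fun_prop))
  have hmin : ∀ y, ∃ s ∈ Icc 0 t, ∀ s' ∈ Icc 0 t, v s y ≤ v s' y := fun y =>
    isCompact_Icc.exists_isMinOn (nonempty_Icc.2 ht) (hcont y)
  choose τ hτ hτmin using hmin
  have hxS : x ∈ S := by
    by_contra hx
    exact absurd (hout t ⟨ht, le_rfl⟩ x hx) (not_le.2 hneg)
  -- `S` is finite and each time minimum is attained, so a negative value of `v` produces a global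
  -- negative minimum over `[0, t] × I`, at the time `τ z` and the site `z`.
  obtain ⟨z, hzS, hz⟩ := S.exists_min_image (fun y => v (τ y) y) ⟨x, hxS⟩
  have hzneg : v (τ z) z < 0 := ((hz x hxS).trans (hτmin x t ⟨ht, le_rfl⟩)).trans_lt hneg
  have hall : ∀ s ∈ Icc 0 t, ∀ y, v (τ z) z ≤ v s y := by
    intro s hs y
    by_cases hy : y ∈ S
    · exact (hz y hy).trans (hτmin y s hs)
    · exact hzneg.le.trans (hout s hs y hy)
  set s₀ := τ z
  have hs₀ : s₀ ∈ Icc 0 t := hτ z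
  have hs₀pos : 0 < s₀ := by
    refine lt_of_le_of_ne hs₀.1 fun h => ?_
    have : 0 ≤ v s₀ z := by
      have := h0 z
      have := polyWeight_pos (k + 1) z
      simp only [hv, ← h]
      positivity
    linarith
  have hd : HasDerivAt (fun s => v s z) (birthDeathGen lam mu (u s₀) z +
      ε * (Real.exp (K * s₀) * K * polyWeight (k + 1) z)) s₀ := by
    refine (hu.hasDerivAt z s₀ hs₀pos).add (HasDerivAt.const_mul _ (HasDerivAt.mul_const ?_ _))
    have h1 : HasDerivAt (fun s => K * s) K s₀ := by simpa using (hasDerivAt_id s₀).const_mul K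
    exact h1.exp
  have hdle : birthDeathGen lam mu (u s₀) z +
      ε * (Real.exp (K * s₀) * K * polyWeight (k + 1) z) ≤ 0 := by
    have hloc : IsLocalMinOn (fun s => v s z) (Icc 0 t) s₀ :=
      IsMinOn.localize fun s hs => hall s hs z
    -- The minimum may sit at the right end `t`, so only the direction towards `0` is used; this
    -- already gives that the time derivative is at most `0`.
    have hmem : (0 : ℝ) - s₀ ∈ posTangentConeAt (Icc 0 t) s₀ :=
      sub_mem_posTangentConeAt_of_segment_subset
        ((convex_Icc 0 t).segment_subset hs₀ ⟨le_rfl, ht⟩)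
    have := hloc.hasFDerivWithinAt_nonneg hd.hasFDerivAt.hasFDerivWithinAt hmem
    simp only [zero_sub, ContinuousLinearMap.toSpanSingleton_apply, smul_eq_mul] at this
    by_contra! hpos
    nlinarith
  -- At a spatial minimum the generator is nonnegative, which contradicts the derivative bound by
  -- the strict inequality `C < K`.
  have hgen : 0 ≤ birthDeathGen lam mu (v s₀) z :=
    add_nonneg
      (mul_nonneg (hP.lam_nonneg z z.2) (sub_nonneg.2 (hall s₀ hs₀ _)))
      (mul_nonneg (hP.mu_nonneg z z.2) (sub_nonneg.2 (hall s₀ hs₀ _)))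
  rw [hv, birthDeathGen_add, birthDeathGen_const_mul, birthDeathGen_const_mul] at hgen
  have h5 : ε * (Real.exp (K * s₀) * birthDeathGen lam mu (polyWeight (k + 1)) z) <
      ε * (Real.exp (K * s₀) * (K * polyWeight (k + 1) z)) := by
    refine mul_lt_mul_of_pos_left (mul_lt_mul_of_pos_left ((hC z).trans_lt ?_) (Real.exp_pos _)) hε
    exact mul_lt_mul_of_pos_right hCK (polyWeight_pos _ _)
  linarith

theorem eq_of_initial_eq (hP : PolyBirthDeath I lam mu) (hu : IsBackwardSolution lam mu u)
    (hv : IsBackwardSolution lam mu v) (h0 : ∀ x, u 0 x = v 0 x) {t : ℝ} (ht : 0 ≤ t) (x : I) :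
    u t x = v t x := by
  refine le_antisymm (sub_nonneg.1 ((hv.sub hu).nonneg hP (fun y => ?_) ht x))
    (sub_nonneg.1 ((hu.sub hv).nonneg hP (fun y => ?_) ht x)) <;> simp [h0]

end IsBackwardSolution

end BirthDeath

/-! ### The transition semigroup on functions of polynomial growth. -/

section TransitionSemigroup

/-- The action of the transition densities on real functions. -/
noncomputable def transitionSemigroup {E : Type*} (Q : Matrix E E ℝ) (h : E → ℝ) (t : ℝ) (x : E) :
    ℝ :=
  ∑' y, transitionDensity Q t x y * h y

theorem transitionDensity_nonneg {E : Type*} (Q : Matrix E E ℝ) (t : ℝ) (x y : E) :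
    0 ≤ transitionDensity Q t x y :=
  ENNReal.toReal_nonneg

variable {I : Set ℤ} {lam mu : ℤ → ℝ}

namespace PolyBirthDeath

theorem coe_upNeighbor (hP : PolyBirthDeath I lam mu) (x : I) :
    ((upNeighbor x : I) : ℤ) = x + 1 := by
  rw [upNeighbor, dif_pos (hP.succ_mem x x.2)]

theorem coe_downNeighbor {x : I} (hx : (x : ℤ) - 1 ∈ I) :
    ((downNeighbor x : I) : ℤ) = x - 1 := by
  rw [downNeighbor, dif_pos hx]

theorem tsum_birthDeathMatrix (hP : PolyBirthDeath I lam mu) (F : I → ℝ≥0∞) (x : I) :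
    ∑' z : {z : I // z ≠ x}, ENNReal.ofReal (birthDeathMatrix I lam mu x z) * F z =
      ENNReal.ofReal (lam x) * F (upNeighbor x) + ENNReal.ofReal (mu x) * F (downNeighbor x) := by
  classical
  have hup := hP.coe_upNeighbor x
  have hupx : upNeighbor x ≠ x := fun h => by
    rw [h] at hup
    omega
  have hmem : ∀ z : I, z ∈ ({z | z ≠ x} : Set I) ↔ z ≠ x := fun z => Iff.rfl
  rw [show ∑' z : {z : I // z ≠ x}, ENNReal.ofReal (birthDeathMatrix I lam mu x z) * F z =
      ∑' z : I, ({z | z ≠ x} : Set I).indicator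
        (fun z => ENNReal.ofReal (birthDeathMatrix I lam mu x z) * F z) z from
    tsum_subtype ({z | z ≠ x} : Set I) fun z =>
      ENNReal.ofReal (birthDeathMatrix I lam mu x z) * F z]
  have hval1 : birthDeathMatrix I lam mu x (upNeighbor x) = lam x := by
    rw [birthDeathMatrix, if_pos hup]
  by_cases hx : (x : ℤ) - 1 ∈ I
  · have hdown := coe_downNeighbor hx
    have hdx : downNeighbor x ≠ x := fun h => by
      rw [h] at hdown
      omega
    have hud : upNeighbor x ≠ downNeighbor x := fun h => by
      rw [h] at hup
      omega
    have hval2 : birthDeathMatrix I lam mu x (downNeighbor x) = mu x := by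
      rw [birthDeathMatrix, if_neg (by omega), if_neg (by omega), if_pos hdown]
    rw [tsum_eq_sum (s := {upNeighbor x, downNeighbor x}), Finset.sum_pair hud,
      indicator_of_mem ((hmem _).2 hupx), indicator_of_mem ((hmem _).2 hdx), hval1, hval2]
    intro z hz
    simp only [Finset.mem_insert, Finset.mem_singleton, not_or, ← Subtype.coe_inj, hup, hdown] at hz
    by_cases hzx : z = x
    · exact indicator_of_notMem (fun h => (hmem z).1 h hzx) _
    · have hzx' : (z : ℤ) ≠ x := fun h => hzx (Subtype.ext h)
      rw [indicator_of_mem ((hmem _).2 hzx), birthDeathMatrix, if_neg hz.1, if_neg hzx',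
        if_neg hz.2, ENNReal.ofReal_zero, zero_mul]
  · have hmu : mu x = 0 := by
      by_contra h
      exact hx (hP.pred_mem x x.2 h)
    rw [tsum_eq_single (upNeighbor x), indicator_of_mem ((hmem _).2 hupx), hval1, hmu]
    · simp
    intro z hz
    by_cases hzx : z = x
    · exact indicator_of_notMem (fun h => (hmem z).1 h hzx) _
    · have hzx' : (z : ℤ) ≠ x := fun h => hzx (Subtype.ext h)
      have hz' : (z : ℤ) ≠ x + 1 := fun h => hz (Subtype.ext (h.trans hup.symm))
      have hz2 : (z : ℤ) ≠ x - 1 := fun h => hx (h ▸ z.2)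
      rw [indicator_of_mem ((hmem _).2 hzx), birthDeathMatrix, if_neg hz', if_neg hzx',
        if_neg hz2, ENNReal.ofReal_zero, zero_mul]

theorem birthDeathMatrix_self (x : I) : birthDeathMatrix I lam mu x x = -lam x - mu x := by
  simp [birthDeathMatrix]

theorem minimalSemigroup_polyWeight_le (hP : PolyBirthDeath I lam mu) (k : ℕ) :
    ∃ C : ℝ, 0 ≤ C ∧ ∀ t, 0 ≤ t → ∀ x,
      minimalSemigroup (birthDeathMatrix I lam mu) (fun y => ENNReal.ofReal (polyWeight k y)) t x ≤
        ENNReal.ofReal (Real.exp (C * t) * polyWeight k x) := by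
  obtain ⟨C, hC⟩ := hP.lyapunov k
  set K := |C| + 1
  have hCK : C < K := by linarith [le_abs_self C]
  have hK0 : 0 < K := by positivity
  refine ⟨K, hK0.le, fun t ht x => ?_⟩
  rw [ENNReal.ofReal_mul (Real.exp_pos _).le]
  refine minimalSemigroup_le _ (fun y => ?_) (fun y => ?_) ht x
  · rw [birthDeathMatrix_self]
    linarith [hP.lam_nonneg y y.2, hP.mu_nonneg y y.2]
  · have hl := hP.lam_nonneg y y.2
    have hm := hP.mu_nonneg y y.2
    rw [hP.tsum_birthDeathMatrix fun y => ENNReal.ofReal (polyWeight k y), birthDeathMatrix_self,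
      ← ENNReal.ofReal_mul hl, ← ENNReal.ofReal_mul hm,
      ← ENNReal.ofReal_add (mul_nonneg hl (polyWeight_pos _ _).le)
        (mul_nonneg hm (polyWeight_pos _ _).le), ← ENNReal.ofReal_mul (by linarith)]
    refine ENNReal.ofReal_le_ofReal ?_
    have h1 := hC y
    have h2 := mul_le_mul_of_nonneg_right hCK.le (polyWeight_pos k y).le
    simp only [birthDeathGen] at h1
    linarith

theorem minimalSemigroup_le_of_le (hP : PolyBirthDeath I lam mu) (k : ℕ) :
    ∃ C : ℝ, 0 ≤ C ∧ ∀ (M : ℝ) (h : I → ℝ), 0 ≤ M → (∀ x, h x ≤ M * polyWeight k x) →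
      ∀ t, 0 ≤ t → ∀ x,
        minimalSemigroup (birthDeathMatrix I lam mu) (fun y => ENNReal.ofReal (h y)) t x ≤
          ENNReal.ofReal (M * (Real.exp (C * t) * polyWeight k x)) := by
  obtain ⟨C, hC0, hC⟩ := hP.minimalSemigroup_polyWeight_le k
  refine ⟨C, hC0, fun M h hM hh t ht x => ?_⟩
  rw [ENNReal.ofReal_mul hM]
  refine le_trans ?_ (mul_le_mul_right (hC t ht x) _)
  rw [minimalSemigroup, minimalSemigroup, ← ENNReal.tsum_mul_left]
  refine ENNReal.tsum_le_tsum fun y => ?_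
  rw [mul_left_comm, ← ENNReal.ofReal_mul hM]
  exact mul_le_mul_right (ENNReal.ofReal_le_ofReal (hh y)) _

/-- The weight of index `0` is the constant `2`, so its Lyapunov bound controls every single
transition probability. Hence `toReal` in `transitionDensity` loses nothing. -/
theorem iSup_jumpTransition_ne_top (hP : PolyBirthDeath I lam mu) {t : ℝ} (ht : 0 ≤ t) (x y : I) :
    ⨆ k, jumpTransition (birthDeathMatrix I lam mu) k t x y ≠ ⊤ := by
  obtain ⟨C, -, hC⟩ := hP.minimalSemigroup_polyWeight_le 0
  refine ne_top_of_le_ne_top ENNReal.ofReal_ne_top (le_trans ?_ (hC t ht x))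
  refine le_trans ?_ (ENNReal.le_tsum y)
  refine le_mul_of_one_le_right' ?_
  rw [ENNReal.one_le_ofReal]
  exact one_le_polyWeight 0 y

theorem ofReal_transitionDensity_mul (hP : PolyBirthDeath I lam mu) {t : ℝ} (ht : 0 ≤ t) (x y : I)
    (r : ℝ) :
    ENNReal.ofReal (transitionDensity (birthDeathMatrix I lam mu) t x y * r) =
      (⨆ k, jumpTransition (birthDeathMatrix I lam mu) k t x y) * ENNReal.ofReal r := by
  rw [ENNReal.ofReal_mul (transitionDensity_nonneg _ _ _ _), transitionDensity,
    ENNReal.ofReal_toReal (hP.iSup_jumpTransition_ne_top ht x y)]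

theorem summable_transitionDensity_mul (hP : PolyBirthDeath I lam mu) {t : ℝ} (ht : 0 ≤ t) (x : I)
    {h : I → ℝ} {k : ℕ} {M : ℝ} (hh : ∀ x, |h x| ≤ M * polyWeight k x) :
    Summable fun y => transitionDensity (birthDeathMatrix I lam mu) t x y * h y := by
  obtain ⟨C, -, hC⟩ := hP.minimalSemigroup_le_of_le k
  have hM : 0 ≤ M := by
    by_contra! hM
    have := mul_neg_of_neg_of_pos hM (polyWeight_pos k x)
    linarith [hh x, abs_nonneg (h x)]
  have hle := hC M (fun y => |h y|) hM hh t ht x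
  rw [minimalSemigroup] at hle
  simp only [← hP.ofReal_transitionDensity_mul ht] at hle
  have hs := ENNReal.summable_toReal (ne_top_of_le_ne_top ENNReal.ofReal_ne_top hle)
  refine Summable.of_norm (hs.congr fun y => ?_)
  rw [Real.norm_eq_abs, abs_mul, abs_of_nonneg (transitionDensity_nonneg _ _ _ _),
    ENNReal.toReal_ofReal (mul_nonneg (transitionDensity_nonneg _ _ _ _) (abs_nonneg _))]

theorem ofReal_transitionSemigroup (hP : PolyBirthDeath I lam mu) {t : ℝ} (ht : 0 ≤ t) (x : I)
    {h : I → ℝ} {k : ℕ} {M : ℝ} (hh : ∀ x, |h x| ≤ M * polyWeight k x) (h0 : ∀ x, 0 ≤ h x) :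
    ENNReal.ofReal (transitionSemigroup (birthDeathMatrix I lam mu) h t x) =
      minimalSemigroup (birthDeathMatrix I lam mu) (fun y => ENNReal.ofReal (h y)) t x := by
  rw [transitionSemigroup, ENNReal.ofReal_tsum_of_nonneg
    (fun y => mul_nonneg (transitionDensity_nonneg _ _ _ _) (h0 y))
    (hP.summable_transitionDensity_mul ht x hh), minimalSemigroup]
  exact tsum_congr fun y => hP.ofReal_transitionDensity_mul ht x y _

theorem isBackwardSolution_of_nonneg (hP : PolyBirthDeath I lam mu)
    {h : I → ℝ} {k : ℕ} {M : ℝ} (hh : ∀ x, |h x| ≤ M * polyWeight k x) (h0 : ∀ x, 0 ≤ h x) :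
    IsBackwardSolution lam mu (transitionSemigroup (birthDeathMatrix I lam mu) h) ∧
      ∀ x, transitionSemigroup (birthDeathMatrix I lam mu) h 0 x = h x := by
  set Q := birthDeathMatrix I lam mu with hQ
  set u := transitionSemigroup Q h with hu
  set H : I → ℝ≥0∞ := fun y => ENNReal.ofReal (h y) with hH
  have hu0 : ∀ t x, 0 ≤ u t x := fun t x =>
    tsum_nonneg fun y => mul_nonneg (transitionDensity_nonneg _ _ _ _) (h0 y)
  have hus : ∀ t, 0 ≤ t → ∀ x, u t x = (minimalSemigroup Q H t x).toReal := fun t ht x => by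
    rw [← hP.ofReal_transitionSemigroup ht x hh h0, ENNReal.toReal_ofReal (hu0 t x)]
  -- On an empty `I` the growth bound does not force `M ≥ 0`.
  rcases isEmpty_or_nonempty I with hI | ⟨⟨x₁⟩⟩
  · exact ⟨⟨fun x => isEmptyElim x, fun x => isEmptyElim x,
      fun T => ⟨0, 0, fun t _ x => isEmptyElim x⟩⟩, fun x => isEmptyElim x⟩
  have hM : 0 ≤ M := by
    by_contra! hM
    have := mul_neg_of_neg_of_pos hM (polyWeight_pos k x₁)
    linarith [hh x₁, abs_nonneg (h x₁)]
  obtain ⟨C, hC0, hC⟩ := hP.minimalSemigroup_le_of_le k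
  have hbound : ∀ t, 0 ≤ t → ∀ x, u t x ≤ M * (Real.exp (C * t) * polyWeight k x) := by
    intro t ht x
    rw [← ENNReal.ofReal_le_ofReal_iff (mul_nonneg hM
      (mul_nonneg (Real.exp_pos _).le (polyWeight_pos _ _).le)),
      hP.ofReal_transitionSemigroup ht x hh h0]
    exact hC M h hM (fun y => (le_abs_self _).trans (hh y)) t ht x
  -- The inflow into the backward equation. Truncating time at `0` makes it measurable and locally
  -- bounded on the whole line.
  set G : I → ℝ → ℝ := fun x s =>
    lam x * u (max s 0) (upNeighbor x) + mu x * u (max s 0) (downNeighbor x) with hG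
  have hG0 : ∀ x s, 0 ≤ G x s := fun x s =>
    add_nonneg (mul_nonneg (hP.lam_nonneg x x.2) (hu0 _ _))
      (mul_nonneg (hP.mu_nonneg x x.2) (hu0 _ _))
  have hmeas : ∀ x, Measurable fun s => u (max s 0) x := by
    intro x
    have : (fun s => u (max s 0) x) =
        fun s => (minimalSemigroup Q H (max s 0) x).toReal := funext fun s =>
      hus _ (le_max_right _ _) x
    rw [this]
    exact ((measurable_minimalSemigroup Q H x).comp (by fun_prop)).ennreal_toReal
  have hGmeas : ∀ x, Measurable (G x) := fun x =>
    ((hmeas _).const_mul _).add ((hmeas _).const_mul _)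
  have hGint : ∀ x (φ : ℝ → ℝ), Continuous φ → ∀ a b,
      IntervalIntegrable (fun s => φ s * G x s) volume a b := by
    intro x φ hφ a b
    have hc : Continuous fun s => |φ s| *
        (lam x * (M * (Real.exp (C * max s 0) * polyWeight k (upNeighbor x))) +
        mu x * (M * (Real.exp (C * max s 0) * polyWeight k (downNeighbor x)))) := by fun_prop
    refine (hc.intervalIntegrable a b).mono_fun'
      (hφ.measurable.mul (hGmeas x)).aestronglyMeasurable (ae_of_all _ fun s => ?_)
    simp only [Real.norm_eq_abs, abs_mul, abs_of_nonneg (hG0 x s)]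
    refine mul_le_mul_of_nonneg_left (add_le_add ?_ ?_) (abs_nonneg _)
    · exact mul_le_mul_of_nonneg_left (hbound _ (le_max_right _ _) _) (hP.lam_nonneg x x.2)
    · exact mul_le_mul_of_nonneg_left (hbound _ (le_max_right _ _) _) (hP.mu_nonneg x x.2)
  have heq : ∀ x t, 0 ≤ t → u t x = Real.exp (Q x x * t) *
      (h x + ∫ s in (0 : ℝ)..t, Real.exp (-(Q x x * s)) * G x s) := by
    intro x t ht
    have hI : ∫⁻ s in Icc (0 : ℝ) t, ENNReal.ofReal (Real.exp (Q x x * s)) *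
        ∑' z : {z : I // z ≠ x}, ENNReal.ofReal (Q x z) * minimalSemigroup Q H (t - s) z =
        ENNReal.ofReal (∫ s in (0 : ℝ)..t, Real.exp (Q x x * (t - s)) * G x s) := by
      rw [lintegral_Icc_conv_comm (fun s => ENNReal.ofReal (Real.exp (Q x x * s)))
        (fun s => ∑' z : {z : I // z ≠ x}, ENNReal.ofReal (Q x z) * minimalSemigroup Q H s z),
        intervalIntegral.integral_of_le ht, ← integral_Icc_eq_integral_Ioc,
        ofReal_integral_eq_lintegral_ofReal]
      · refine setLIntegral_congr_fun measurableSet_Icc fun s hs => ?_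
        rw [ENNReal.ofReal_mul (Real.exp_pos _).le, hQ,
          hP.tsum_birthDeathMatrix fun z => minimalSemigroup Q H s z]
        congr 1
        simp only [hG, max_eq_left hs.1]
        rw [ENNReal.ofReal_add (mul_nonneg (hP.lam_nonneg x x.2) (hu0 _ _))
          (mul_nonneg (hP.mu_nonneg x x.2) (hu0 _ _)), ENNReal.ofReal_mul (hP.lam_nonneg x x.2),
          ENNReal.ofReal_mul (hP.mu_nonneg x x.2), hP.ofReal_transitionSemigroup hs.1 _ hh h0,
          hP.ofReal_transitionSemigroup hs.1 _ hh h0]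
      · have := hGint x (fun s => Real.exp (Q x x * (t - s))) (by fun_prop) 0 t
        rwa [intervalIntegrable_iff_integrableOn_Icc_of_le ht] at this
      · exact ae_of_all _ fun s => mul_nonneg (Real.exp_pos _).le (hG0 x s)
    have hnn : 0 ≤ ∫ s in (0 : ℝ)..t, Real.exp (Q x x * (t - s)) * G x s :=
      intervalIntegral.integral_nonneg ht fun s _ => mul_nonneg (Real.exp_pos _).le (hG0 x s)
    rw [hus t ht, minimalSemigroup_eq, hI, hH, ← ENNReal.ofReal_mul (Real.exp_pos _).le,
      ← ENNReal.ofReal_add (mul_nonneg (Real.exp_pos _).le (h0 x)) hnn,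
      ENNReal.toReal_ofReal (add_nonneg (mul_nonneg (Real.exp_pos _).le (h0 x)) hnn), mul_add,
      ← intervalIntegral.integral_const_mul]
    congr 1
    refine intervalIntegral.integral_congr fun s _ => ?_
    rw [← mul_assoc, ← Real.exp_add]
    congr 2
    ring
  -- Regularity is bootstrapped from `heq`: a locally bounded measurable `G` makes `u` continuous,
  -- hence `G` is continuous, hence `u` is differentiable.
  have hcont : ∀ x, ContinuousOn (fun t => u t x) (Ici 0) := by
    intro x
    refine ContinuousOn.congr (Continuous.continuousOn ?_) fun t ht => heq x t ht
    exact Continuous.mul (by fun_prop) (continuous_const.add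
      (intervalIntegral.continuous_primitive (hGint x _ (by fun_prop)) 0))
  have hGcont : ∀ x, Continuous (G x) := by
    have : ∀ x, Continuous fun s => u (max s 0) x := fun x =>
      (hcont x).comp_continuous (by fun_prop) fun s => le_max_right s 0
    exact fun x => ((this _).const_mul _).add ((this _).const_mul _)
  refine ⟨⟨hcont, fun x t ht => ?_, fun T => ?_⟩, fun x => ?_⟩
  · have hd1 : HasDerivAt (fun t => Real.exp (Q x x * t)) (Real.exp (Q x x * t) * Q x x) t := by
      have h1 : HasDerivAt (fun s => Q x x * s) (Q x x) t := by
        simpa using (hasDerivAt_id t).const_mul (Q x x)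
      exact h1.exp
    have hd2 : HasDerivAt (fun t => h x + ∫ s in (0 : ℝ)..t, Real.exp (-(Q x x * s)) * G x s)
        (Real.exp (-(Q x x * t)) * G x t) t := by
      refine HasDerivAt.const_add _ ?_
      have hc : Continuous fun s => Real.exp (-(Q x x * s)) * G x s :=
        Continuous.mul (by fun_prop) (hGcont x)
      exact (hc.integral_hasStrictDerivAt 0 t).hasDerivAt
    have hd := hd1.mul hd2
    refine (hd.congr_of_eventuallyEq ?_).congr_deriv ?_
    · filter_upwards [lt_mem_nhds ht] with s hs
      exact heq x s hs.le
    · have h3 : Real.exp (Q x x * t) * (Real.exp (-(Q x x * t)) * G x t) = G x t := by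
        rw [← mul_assoc, ← Real.exp_add, add_neg_cancel, Real.exp_zero, one_mul]
      rw [mul_right_comm, ← heq x t ht.le, h3, hQ, birthDeathMatrix_self, birthDeathGen]
      simp only [hG, max_eq_left ht.le]
      ring
  · refine ⟨k, M * Real.exp (C * T), fun t ht x => ?_⟩
    rw [abs_of_nonneg (hu0 t x), mul_assoc]
    refine (hbound t ht.1 x).trans (mul_le_mul_of_nonneg_left ?_ hM)
    refine mul_le_mul_of_nonneg_right (Real.exp_le_exp.2 ?_) (polyWeight_pos _ _).le
    exact mul_le_mul_of_nonneg_left ht.2 hC0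
  · rw [heq x 0 le_rfl]
    simp

/-- The transition semigroup solves the backward equation for data of polynomial growth. -/
theorem isBackwardSolution (hP : PolyBirthDeath I lam mu)
    {h : I → ℝ} {k : ℕ} {M : ℝ} (hh : ∀ x, |h x| ≤ M * polyWeight k x) :
    IsBackwardSolution lam mu (transitionSemigroup (birthDeathMatrix I lam mu) h) ∧
      ∀ x, transitionSemigroup (birthDeathMatrix I lam mu) h 0 x = h x := by
  set Q := birthDeathMatrix I lam mu
  have hp : ∀ x, |max (h x) 0| ≤ M * polyWeight k x := fun x =>
    (abs_max_le_max_abs_abs.trans (by simp)).trans (hh x)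
  have hn : ∀ x, |max (-h x) 0| ≤ M * polyWeight k x := fun x =>
    (abs_max_le_max_abs_abs.trans (by simp)).trans (hh x)
  obtain ⟨h1, h2⟩ := hP.isBackwardSolution_of_nonneg hp fun x => le_max_right _ _
  obtain ⟨h3, h4⟩ := hP.isBackwardSolution_of_nonneg hn fun x => le_max_right _ _
  have hsplit : ∀ x, h x = max (h x) 0 - max (-h x) 0 := fun x => by
    rcases le_total 0 (h x) with hx | hx
    · rw [max_eq_left hx, max_eq_right (by linarith), sub_zero]
    · rw [max_eq_right hx, max_eq_left (by linarith), zero_sub, neg_neg]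
  have heq : ∀ t, 0 ≤ t → ∀ x, transitionSemigroup Q h t x =
      transitionSemigroup Q (fun x => max (h x) 0) t x -
        transitionSemigroup Q (fun x => max (-h x) 0) t x := by
    intro t ht x
    rw [transitionSemigroup, transitionSemigroup, transitionSemigroup,
      ← (hP.summable_transitionDensity_mul ht x hp).tsum_sub
        (hP.summable_transitionDensity_mul ht x hn)]
    exact tsum_congr fun y => by rw [← mul_sub, ← hsplit]
  have hs := h1.sub h3
  refine ⟨⟨fun x => (hs.continuousOn x).congr fun t ht => heq t ht x, fun x t ht => ?_,
    fun T => ?_⟩, fun x => ?_⟩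
  · refine ((hs.hasDerivAt x t ht).congr_of_eventuallyEq ?_).congr_deriv ?_
    · filter_upwards [lt_mem_nhds ht] with s hs
      exact heq s hs.le x
    · simp only [birthDeathGen, heq t ht.le]
      rfl
  · obtain ⟨l, N, hN⟩ := hs.growth T
    exact ⟨l, N, fun t ht x => by rw [heq t ht.1 x]; exact hN t ht x⟩
  · rw [heq 0 le_rfl, h2, h4, ← hsplit]

end PolyBirthDeath

end TransitionSemigroup

/-! ### The generator on polynomials. -/

section PolynomialMoments

open Polynomial

/-- The image of `X ^ k` under the birth and death generator with rates `a X ^ 2 + b X + c` and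
`a X ^ 2 + b' X + c'`. -/
noncomputable def genPoly (a b c b' c' : ℝ) (k : ℕ) : ℝ[X] :=
  (C a * X ^ 2 + C b * X + C c) * ((X + 1) ^ k - X ^ k) +
    (C a * X ^ 2 + C b' * X + C c') * ((X + C (-1)) ^ k - X ^ k)

theorem coeff_quadratic_mul (a b c : ℝ) (p : ℝ[X]) (i : ℕ) :
    ((C a * X ^ 2 + C b * X + C c) * p).coeff (i + 2) =
      a * p.coeff i + b * p.coeff (i + 1) + c * p.coeff (i + 2) := by
  rw [add_mul, add_mul, mul_assoc, mul_assoc, coeff_add, coeff_add, coeff_C_mul, coeff_C_mul,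
    coeff_C_mul, coeff_X_pow_mul, coeff_X_mul]

theorem coeff_X_add_C_pow_sub (r : ℝ) (k i : ℕ) :
    ((X + C r) ^ k - X ^ k).coeff i = if i < k then r ^ (k - i) * k.choose i else 0 := by
  rw [coeff_sub, coeff_X_add_C_pow, coeff_X_pow]
  rcases lt_trichotomy i k with h | h | h
  · rw [if_pos h, if_neg h.ne, sub_zero]
  · simp [h]
  · simp [h.not_gt, h.ne', Nat.choose_eq_zero_of_lt h]

/-- Since both rates have leading coefficient `a`, the terms `±a k X^{k+1}` cancel and the degree
does not rise. The diagonal coefficient collects `2a` times `k.choose 2` from the second-order terms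
and `(b - b') k` from the first-order ones. -/
theorem genPoly_coeff (a b c b' c' : ℝ) {k j : ℕ} (hkj : k ≤ j) :
    (genPoly a b c b' c' k).coeff j =
      if j = k then a * (k * (k - 1)) + (b - b') * k else 0 := by
  rcases k with _ | _ | m
  · simp [genPoly]
  · have h1 : genPoly a b c b' c' (0 + 1) = C (b - b') * X + C (c - c') := by
      simp only [genPoly, zero_add, pow_one, map_sub, map_neg, map_one]
      ring
    rw [h1, coeff_add, coeff_C_mul, coeff_X, coeff_C]
    rcases j with _ | _ | j
    · omega
    · simp
    · simp
  · obtain ⟨i, rfl⟩ : ∃ i, j = m + i + 2 := ⟨j - m - 2, by omega⟩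
    rw [genPoly, show (X + 1 : ℝ[X]) = X + C 1 by rw [map_one], coeff_add, coeff_quadratic_mul,
      coeff_quadratic_mul]
    simp only [coeff_X_add_C_pow_sub]
    -- The cases `j = k`, `j = k + 1` (where the cancellation happens) and `j > k + 1`.
    rcases i with _ | _ | i
    · have h1 : (m + 1 + 1).choose m = (m + 2) * (m + 1) / 2 := by
        rw [← Nat.choose_symm_of_eq_add (show m + 1 + 1 = 2 + m by ring), Nat.choose_two_right]
        rfl
      have h2 : (((m + 1 + 1).choose m : ℕ) : ℝ) = (m + 2) * (m + 1) / 2 := by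
        rw [h1, Nat.cast_div]
        · push_cast
          ring
        · exact (Nat.even_mul_pred_self (m + 2)).two_dvd
        · norm_num
      have h3 : (m + 1 + 1).choose (m + 1) = m + 2 := Nat.choose_succ_self_right _
      simp only [add_zero, h2, h3,
        show m < m + 1 + 1 by omega, show m + 1 < m + 1 + 1 by omega, if_true, if_false,
        show m + 1 + 1 - m = 2 by omega, show m + 1 + 1 - (m + 1) = 1 by omega,
        show ¬(m + 2 < m + 1 + 1) by omega]
      push_cast
      ring
    · simp only [show m + (0 + 1) < m + 1 + 1 by omega, if_true,
        show ¬(m + (0 + 1) + 1 < m + 1 + 1) by omega,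
        show ¬(m + (0 + 1) + 2 < m + 1 + 1) by omega, if_false,
        show m + 1 + 1 - (m + (0 + 1)) = 1 by omega,
        show ¬(m + (0 + 1) + 2 = m + 1 + 1) by omega]
      ring
    · simp only [show ¬(m + (i + 1 + 1) < m + 1 + 1) by omega,
        show ¬(m + (i + 1 + 1) + 1 < m + 1 + 1) by omega,
        show ¬(m + (i + 1 + 1) + 2 < m + 1 + 1) by omega, if_false,
        show ¬(m + (i + 1 + 1) + 2 = m + 1 + 1) by omega]
      ring

theorem genPoly_eval (a b c b' c' : ℝ) {k n : ℕ} (hkn : k < n) (x : ℝ) :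
    (genPoly a b c b' c' k).eval x =
      ∑ j : Fin n, (genPoly a b c b' c' k).coeff j * x ^ (j : ℕ) := by
  rw [Fin.sum_univ_eq_sum_range (fun j => (genPoly a b c b' c' k).coeff j * x ^ j)]
  refine eval_eq_sum_range' ?_ x
  rw [Nat.lt_iff_add_one_le]
  refine le_trans (Nat.succ_le_succ ?_) hkn
  rw [natDegree_le_iff_coeff_eq_zero]
  intro j hj
  rw [genPoly_coeff _ _ _ _ _ hj.le, if_neg hj.ne']

end PolynomialMoments

/-! ### Quadratic rates: Lyapunov property and moments as a matrix exponential. -/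

section QuadraticRates

variable {I : Set ℤ} {a b c b' c' : ℝ}

/-- A left neighbour is missing only where the death rate vanishes, so the boundary does not disturb
the polynomial formula. -/
theorem birthDeathGen_pow (hsucc : ∀ x ∈ I, x + 1 ∈ I)
    (hpred : ∀ x ∈ I, quadRate a b' c' x ≠ 0 → x - 1 ∈ I) (k : ℕ) (x : I) :
    birthDeathGen (quadRate a b c) (quadRate a b' c') (fun y : I => ((y : ℤ) : ℝ) ^ k) x =
      (genPoly a b c b' c' k).eval ((x : ℤ) : ℝ) := by
  have hup : (((upNeighbor x : I) : ℤ) : ℝ) = (x : ℤ) + 1 := by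
    rw [upNeighbor, dif_pos (hsucc x x.2)]
    push_cast
    rfl
  have hdown : quadRate a b' c' x *
      ((((downNeighbor x : I) : ℤ) : ℝ) ^ k - ((x : ℤ) : ℝ) ^ k) =
      quadRate a b' c' x * ((((x : ℤ) : ℝ) + -1) ^ k - ((x : ℤ) : ℝ) ^ k) := by
    by_cases h : quadRate a b' c' x = 0
    · rw [h, zero_mul, zero_mul]
    · rw [downNeighbor, dif_pos (hpred x x.2 h)]
      push_cast
      rfl
  rw [birthDeathGen, hdown, hup]
  simp [genPoly, quadRate]

theorem abs_pow_le_polyWeight {j k : ℕ} (hjk : j ≤ 2 * k) (x : I) :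
    |((x : ℤ) : ℝ) ^ j| ≤ polyWeight k x := by
  rw [abs_pow, polyWeight, ← (even_two_mul k).pow_abs]
  rcases le_total |((x : ℤ) : ℝ)| 1 with h | h
  · have := pow_le_one₀ (abs_nonneg _) h (n := j)
    have : 0 ≤ |((x : ℤ) : ℝ)| ^ (2 * k) := by positivity
    linarith
  · linarith [pow_le_pow_right₀ h hjk]

theorem polyBirthDeath_quadRate (hsucc : ∀ x ∈ I, x + 1 ∈ I)
    (hpred : ∀ x ∈ I, quadRate a b' c' x ≠ 0 → x - 1 ∈ I)
    (hlam : ∀ x ∈ I, 0 ≤ quadRate a b c x) (hmu : ∀ x ∈ I, 0 ≤ quadRate a b' c' x) :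
    PolyBirthDeath I (quadRate a b c) (quadRate a b' c') where
  succ_mem := hsucc
  pred_mem := hpred
  lam_nonneg := hlam
  mu_nonneg := hmu
  lyapunov k := by
    -- The constant term of the weight is annihilated and `x^{2k}` is mapped to degree at most `2k`;
    -- each monomial is dominated by the weight, so `C` is the sum of the absolute coefficients.
    refine ⟨∑ j : Fin (2 * k + 1), |(genPoly a b c b' c' (2 * k)).coeff j|, fun x => ?_⟩
    have h1 : birthDeathGen (quadRate a b c) (quadRate a b' c') (polyWeight k) x =
        birthDeathGen (quadRate a b c) (quadRate a b' c')
          (fun y : I => ((y : ℤ) : ℝ) ^ (2 * k)) x := by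
      simp only [birthDeathGen, polyWeight]
      ring
    rw [h1, birthDeathGen_pow hsucc hpred, genPoly_eval _ _ _ _ _ (Nat.lt_succ_self _),
      Finset.sum_mul]
    refine Finset.sum_le_sum fun j _ => (le_abs_self _).trans ?_
    rw [abs_mul]
    exact mul_le_mul_of_nonneg_left (abs_pow_le_polyWeight (by omega) x) (abs_nonneg _)

open scoped Matrix.Norms.Operator in
theorem Matrix.hasDerivAt_exp_smul_apply {m : Type*} [Fintype m] [DecidableEq m]
    (A : Matrix m m ℝ) (i j : m) (t : ℝ) :
    HasDerivAt (fun s : ℝ => NormedSpace.exp (s • A) i j) ((NormedSpace.exp (t • A) * A) i j) t := by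
  have h := hasDerivAt_exp_smul_const A t
  exact hasDerivAt_pi.1 (hasDerivAt_pi.1 h i) j

-- Powers of a triangular matrix have the powers of its diagonal on their diagonal, so summing the
-- exponential series gives `exp (A i i)` there.
open scoped Matrix.Norms.Operator in
theorem Matrix.det_exp_of_lowerTriangular {m : Type*} [Fintype m] [LinearOrder m]
    (A : Matrix m m ℝ) (hA : A.BlockTriangular OrderDual.toDual) :
    (NormedSpace.exp A).det = Real.exp A.trace := by
  have hpow : ∀ (k : ℕ) (i : m), (A ^ k) i i = A i i ^ k := by
    intro k i
    induction k with
    | zero => simp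
    | succ k ih =>
      rw [pow_succ, pow_succ, Matrix.mul_apply, Finset.sum_eq_single i, ih]
      · intro j _ hj
        rcases lt_or_gt_of_ne hj with h | h
        · rw [hA (show OrderDual.toDual i < OrderDual.toDual j from h), mul_zero]
        · rw [(hA.pow k) (show OrderDual.toDual j < OrderDual.toDual i from h), zero_mul]
      · simp
  have hdiag : ∀ i, NormedSpace.exp A i i = Real.exp (A i i) := by
    intro i
    have h1 := NormedSpace.exp_series_hasSum_exp' (𝕂 := ℝ) A
    have h2 := Pi.hasSum.1 (Pi.hasSum.1 h1 i) i
    have h3 := NormedSpace.exp_series_hasSum_exp' (𝕂 := ℝ) (A i i)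
    rw [← Real.exp_eq_exp_ℝ] at h3
    have h4 : (fun k : ℕ => ((k.factorial : ℝ)⁻¹ • A ^ k) i i) =
        fun k : ℕ => (k.factorial : ℝ)⁻¹ • A i i ^ k := by
      funext k
      rw [Matrix.smul_apply, hpow]
    rw [h4] at h2
    exact h2.unique h3
  rw [Matrix.det_of_isLowerTriangular _ hA.exp, Matrix.trace, Real.exp_sum]
  exact Finset.prod_congr rfl fun i _ => hdiag i

/-- The matrix of the birth and death generator on polynomials of degree less than `n`. -/
noncomputable def genMatrix (a b c b' c' : ℝ) (n : ℕ) : Matrix (Fin n) (Fin n) ℝ :=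
  Matrix.of fun k j => (genPoly a b c b' c' k).coeff j

theorem trace_genMatrix (a b c b' c' : ℝ) (n : ℕ) :
    (genMatrix a b c b' c' n).trace = vdmEigenvalue a b b' n := by
  have h : ∀ k : Fin n, (genMatrix a b c b' c' n).diag k =
      a * ((k : ℕ) * ((k : ℕ) - 1)) + (b - b') * (k : ℕ) := fun k => by
    rw [Matrix.diag_apply, genMatrix, Matrix.of_apply, genPoly_coeff _ _ _ _ _ le_rfl, if_pos rfl]
  rw [Matrix.trace, Finset.sum_congr rfl fun k _ => h k,
    Fin.sum_univ_eq_sum_range (fun k : ℕ => a * ((k : ℝ) * (k - 1)) + (b - b') * k)]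
  unfold vdmEigenvalue
  induction n with
  | zero => simp
  | succ n ih =>
    rw [Finset.sum_range_succ, ih fun k => by
      rw [Matrix.diag_apply, genMatrix, Matrix.of_apply, genPoly_coeff _ _ _ _ _ le_rfl, if_pos rfl]]
    push_cast
    ring

theorem det_exp_genMatrix (a b c b' c' : ℝ) (n : ℕ) (t : ℝ) :
    (NormedSpace.exp (t • genMatrix a b c b' c' n)).det =
      Real.exp (vdmEigenvalue a b b' n * t) := by
  rw [Matrix.det_exp_of_lowerTriangular, Matrix.trace_smul, trace_genMatrix, smul_eq_mul, mul_comm]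
  intro i j hij
  have hij' : (i : ℕ) < j := hij
  rw [Matrix.smul_apply, genMatrix, Matrix.of_apply, genPoly_coeff _ _ _ _ _ hij'.le,
    if_neg hij'.ne', smul_zero]

/-- Both sides solve the backward equation with polynomial growth and start from `x^k`, so
uniqueness applies. -/
theorem transitionSemigroup_pow
    (hP : PolyBirthDeath I (quadRate a b c) (quadRate a b' c')) {n : ℕ} (k : Fin n) {t : ℝ}
    (ht : 0 ≤ t) (x : I) :
    transitionSemigroup (birthDeathMatrix I (quadRate a b c) (quadRate a b' c'))
        (fun y => ((y : ℤ) : ℝ) ^ (k : ℕ)) t x =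
      ∑ j, NormedSpace.exp (t • genMatrix a b c b' c' n) k j * ((x : ℤ) : ℝ) ^ (j : ℕ) := by
  set A := genMatrix a b c b' c' n with hA
  obtain ⟨h1, h2⟩ := hP.isBackwardSolution (h := fun y : I => ((y : ℤ) : ℝ) ^ (k : ℕ)) (k := k)
    (M := 1) fun y => by
      rw [one_mul]
      exact abs_pow_le_polyWeight (by omega) y
  have hcont : ∀ i j, Continuous fun s : ℝ => NormedSpace.exp (s • A) i j := fun i j =>
    continuous_iff_continuousAt.2 fun s => (Matrix.hasDerivAt_exp_smul_apply A i j s).continuousAt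
  refine h1.eq_of_initial_eq (v := fun t x =>
    ∑ j, NormedSpace.exp (t • A) k j * ((x : ℤ) : ℝ) ^ (j : ℕ)) hP ⟨fun y => ?_, fun y s hs => ?_, fun T => ?_⟩ (fun y => ?_) ht x
  · exact Continuous.continuousOn (continuous_finsetSum _ fun j _ => (hcont k j).mul_const _)
  · refine (HasDerivAt.fun_sum fun j _ =>
      (Matrix.hasDerivAt_exp_smul_apply A k j s).mul_const _).congr_deriv ?_
    rw [birthDeathGen_sum]
    have hg : ∀ l : Fin n, (genPoly a b c b' c' l).eval ((y : ℤ) : ℝ) =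
        ∑ j, A l j * ((y : ℤ) : ℝ) ^ (j : ℕ) := fun l => genPoly_eval _ _ _ _ _ l.2 _
    simp only [birthDeathGen_const_mul, birthDeathGen_pow hP.succ_mem hP.pred_mem, hg,
      Matrix.mul_apply, Finset.sum_mul, Finset.mul_sum]
    rw [Finset.sum_comm]
    exact Finset.sum_congr rfl fun l _ => Finset.sum_congr rfl fun j _ => mul_assoc _ _ _
  · have hb : ∀ j, ∃ B, ∀ s ∈ Icc 0 T, ‖NormedSpace.exp (s • A) k j‖ ≤ B := fun j =>
      isCompact_Icc.exists_bound_of_continuousOn (hcont k j).continuousOn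
    choose B hB using hb
    refine ⟨n, ∑ j, B j, fun s hs y => ?_⟩
    rw [Finset.sum_mul]
    refine (Finset.abs_sum_le_sum_abs _ _).trans (Finset.sum_le_sum fun j _ => ?_)
    rw [abs_mul]
    exact mul_le_mul (hB j s hs) (abs_pow_le_polyWeight (by omega) y) (abs_nonneg _)
      ((norm_nonneg _).trans (hB j s hs))
  · rw [h2, zero_smul, NormedSpace.exp_zero, Finset.sum_eq_single k]
    · simp
    · intro j _ hj
      rw [Matrix.one_apply_ne' hj, zero_mul]
    · simp

/-- The transition semigroup acts on the Vandermonde determinant by the trace of the generator. -/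
theorem det_transitionSemigroup_pow
    (hP : PolyBirthDeath I (quadRate a b c) (quadRate a b' c')) {n : ℕ} {t : ℝ}
    (ht : 0 ≤ t) (x : WeylChamber I n) :
    (Matrix.of fun i k : Fin n =>
      transitionSemigroup (birthDeathMatrix I (quadRate a b c) (quadRate a b' c'))
        (fun y => ((y : ℤ) : ℝ) ^ (k : ℕ)) t (x.1 i)).det =
      Real.exp (vdmEigenvalue a b b' n * t) * vdm x := by
  rw [vdm, ← Matrix.det_vandermonde fun i => ((x.1 i : ℤ) : ℝ), ← det_exp_genMatrix a b c b' c' n t,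
    mul_comm, ← Matrix.det_transpose (NormedSpace.exp _), ← Matrix.det_mul]
  congr 1
  ext i k
  rw [Matrix.of_apply, transitionSemigroup_pow hP k ht, Matrix.mul_apply]
  refine Finset.sum_congr rfl fun j _ => ?_
  rw [Matrix.vandermonde_apply, Matrix.transpose_apply, mul_comm]

end QuadraticRates

/-! ### Duality between the chain and its shifted companion. -/

section Duality

variable {I : Set ℤ} {lam mu lamS : ℤ → ℝ} {r : ℝ}

theorem polyWeight_upNeighbor_le (hP : PolyBirthDeath I lam mu) (k : ℕ) (x : I) :
    polyWeight k (upNeighbor x) ≤ (1 + 4 ^ k) * polyWeight k x := by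
  have h1 : (((upNeighbor x : I) : ℤ) : ℝ) = (x : ℤ) + 1 := by
    rw [hP.coe_upNeighbor]
    push_cast
    rfl
  unfold polyWeight
  rw [h1, pow_mul, pow_mul]
  set y := ((x : ℤ) : ℝ)
  have h2 : ((y + 1) ^ 2) ^ k ≤ 4 ^ k * (1 + (y ^ 2) ^ k) := by
    have h0 : 0 ≤ (y ^ 2) ^ k := by positivity
    rcases le_total (y ^ 2) 1 with h | h
    · calc ((y + 1) ^ 2) ^ k ≤ 4 ^ k := pow_le_pow_left₀ (sq_nonneg _) (by nlinarith) _
        _ ≤ 4 ^ k * (1 + (y ^ 2) ^ k) := le_mul_of_one_le_right (by positivity) (by linarith)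
    · calc ((y + 1) ^ 2) ^ k ≤ (4 * y ^ 2) ^ k :=
            pow_le_pow_left₀ (sq_nonneg _) (by nlinarith [sq_nonneg (y - 1)]) _
        _ = 4 ^ k * (y ^ 2) ^ k := mul_pow _ _ _
        _ ≤ 4 ^ k * (1 + (y ^ 2) ^ k) := by gcongr; linarith
  have h0 : 0 ≤ (y ^ 2) ^ k := by positivity
  linarith

theorem abs_indicator_one_le_polyWeight (s : Set I) (x : I) :
    |s.indicator (1 : I → ℝ) x| ≤ 1 * polyWeight 0 x := by
  rw [one_mul]
  refine le_trans ?_ (one_le_polyWeight 0 x)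
  by_cases h : x ∈ s <;> simp [h]

theorem transitionSemigroup_indicator_singleton (Q : Matrix I I ℝ) (t : ℝ) (x y : I) :
    transitionSemigroup Q (({y} : Set I).indicator 1) t x = transitionDensity Q t x y := by
  rw [transitionSemigroup, tsum_eq_single y]
  · simp
  · intro z hz
    simp [hz]

/-- The differences of the tails of the transition probabilities are, up to an exponential factor,
the transition probabilities of the chain with shifted birth rates. -/
theorem tail_transitionSemigroup_sub
    (hP : PolyBirthDeath I lam mu) (hS : PolyBirthDeath I lamS mu)
    (hlamS : ∀ x, lamS x = lam (x + 1))
    (hr : ∀ x, lam (x + 1) - lam x - mu (x + 1) + mu x = r) {t : ℝ} (ht : 0 ≤ t) (y z : I) :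
    transitionSemigroup (birthDeathMatrix I lam mu) ((Ioi y).indicator 1) t (upNeighbor z) -
      transitionSemigroup (birthDeathMatrix I lam mu) ((Ioi y).indicator 1) t z =
      Real.exp (r * t) * transitionDensity (birthDeathMatrix I lamS mu) t z y := by
  obtain ⟨hF, hF0⟩ := hP.isBackwardSolution (abs_indicator_one_le_polyWeight (Ioi y))
  obtain ⟨hG, hG0⟩ := hS.isBackwardSolution (abs_indicator_one_le_polyWeight {y})
  set F := transitionSemigroup (birthDeathMatrix I lam mu) ((Ioi y).indicator 1)
  have hdownup : ∀ x : I, downNeighbor (upNeighbor x) = x := by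
    intro x
    have hup := hP.coe_upNeighbor x
    refine Subtype.ext ?_
    rw [PolyBirthDeath.coe_downNeighbor, hup, add_sub_cancel_right]
    rw [hup, add_sub_cancel_right]
    exact x.2
  have hupdown : ∀ x : I, mu x ≠ 0 → upNeighbor (downNeighbor x) = x := by
    intro x hx
    refine Subtype.ext ?_
    rw [hP.coe_upNeighbor, PolyBirthDeath.coe_downNeighbor (hP.pred_mem x x.2 hx),
      sub_add_cancel]
  -- With `D(x) = F(x+1) - F(x)`, the difference of the generators at `x + 1` and `x` is `λ(x+1)
  -- D(x+1) + μ(x) D(x-1) - (λ(x) + μ(x+1)) D(x)`. This is the shifted generator plus `r D`, and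
  -- `e^{-rs}` removes the last term.
  have hsol : IsBackwardSolution lamS mu
      fun s x => Real.exp (-(r * s)) * (F s (upNeighbor x) - F s x) := by
    refine ⟨fun x => ?_, fun x s hs => ?_, fun T => ?_⟩
    · exact ContinuousOn.mul (Continuous.continuousOn (by fun_prop))
        ((hF.continuousOn _).sub (hF.continuousOn _))
    · have h1 : HasDerivAt (fun s => Real.exp (-(r * s))) (Real.exp (-(r * s)) * -r) s := by
        have : HasDerivAt (fun s => -(r * s)) (-r) s := by
          simpa using ((hasDerivAt_id' s).const_mul r).fun_neg
        exact this.exp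
      refine (h1.mul ((hF.hasDerivAt (upNeighbor x) s hs).sub (hF.hasDerivAt x s hs))).congr_deriv ?_
      rw [birthDeathGen_const_mul]
      simp only [Pi.sub_apply, birthDeathGen, hdownup, hP.coe_upNeighbor, hlamS, ← hr x]
      -- At a reflecting boundary `D(x-1)` has no meaning, but its factor `μ(x)` is zero.
      have h2 : mu x * (F s (downNeighbor x) - F s x) =
          -(mu x * (F s (upNeighbor (downNeighbor x)) - F s (downNeighbor x))) := by
        by_cases hx : mu x = 0
        · rw [hx, zero_mul, zero_mul, neg_zero]
        · rw [hupdown x hx]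
          ring
      rw [h2]
      ring
    · obtain ⟨k, M, hM⟩ := hF.growth T
      have hM0 : 0 ≤ T → 0 ≤ M := fun hT => by
        have := (abs_nonneg _).trans (hM 0 ⟨le_rfl, hT⟩ z)
        exact nonneg_of_mul_nonneg_left this (polyWeight_pos k z)
      refine ⟨k, Real.exp (|r| * T) * (M * (1 + 4 ^ k) + M), fun s hs x => ?_⟩
      have hT := hs.1.trans hs.2
      rw [abs_mul, abs_of_pos (Real.exp_pos _), mul_assoc]
      refine mul_le_mul (Real.exp_le_exp.2 ?_) ?_ (abs_nonneg _) (Real.exp_pos _).le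
      · calc -(r * s) ≤ |r * s| := neg_le_abs _
          _ = |r| * s := by rw [abs_mul, abs_of_nonneg hs.1]
          _ ≤ |r| * T := mul_le_mul_of_nonneg_left hs.2 (abs_nonneg r)
      · have h1 := hM s hs (upNeighbor x)
        have h2 := hM s hs x
        have h3 := mul_le_mul_of_nonneg_left (polyWeight_upNeighbor_le hP k x) (hM0 hT)
        have h4 := abs_sub (F s (upNeighbor x)) (F s x)
        linarith
  -- The discrete derivative of the indicator of `x > y` is the indicator of `x = y`.
  have h0 : ∀ x, Real.exp (-(r * 0)) * (F 0 (upNeighbor x) - F 0 x) =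
      transitionSemigroup (birthDeathMatrix I lamS mu) (({y} : Set I).indicator 1) 0 x := by
    intro x
    have hup := hP.coe_upNeighbor x
    rw [hF0, hF0, hG0, mul_zero, neg_zero, Real.exp_zero, one_mul]
    simp only [indicator, mem_Ioi, mem_singleton_iff, Pi.one_apply, ← Subtype.coe_lt_coe,
      ← Subtype.coe_inj, hup]
    rcases lt_trichotomy (y : ℤ) x with h | h | h
    · simp [h, h.ne', h.trans (lt_add_one _)]
    · simp [h]
    · simp [h.not_gt, h.ne, show ¬((y : ℤ) < x + 1) by omega]
  have h := hsol.eq_of_initial_eq hS hG h0 ht z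
  rw [transitionSemigroup_indicator_singleton] at h
  rw [← h, ← mul_assoc, ← Real.exp_add, add_neg_cancel, Real.exp_zero, one_mul]

end Duality

/-! ### Andréief's identity on the Weyl chamber. -/

section Andreief

theorem hasSum_prod_pi {α : Type*} {n : ℕ} {f : Fin n → α → ℝ} (hf : ∀ i, Summable (f i)) :
    HasSum (fun y : Fin n → α => ∏ i, f i (y i)) (∏ i, ∑' z, f i z) := by
  induction n with
  | zero => simp
  | succ n ih =>
    rw [← (Fin.consEquiv fun _ => α).hasSum_iff, Fin.prod_univ_succ]
    have h1 := ih fun i => hf i.succ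
    have h2 := summable_mul_of_summable_norm (hf 0).norm h1.summable.norm
    have h3 := tsum_mul_tsum_of_summable_norm (hf 0).norm h1.summable.norm
    rw [← h1.tsum_eq, h3]
    refine h2.hasSum.congr_fun fun p => ?_
    simp [Fin.consEquiv, Fin.prod_univ_succ]

variable {I : Set ℤ} {n : ℕ}

/-- A chamber point is determined by its set of coordinates. Together with the next lemma, this
identifies the tuples of distinct points with pairs of a chamber point and a permutation. -/
theorem weylChamber_comp_perm_injective :
    Function.Injective fun p : WeylChamber I n × Equiv.Perm (Fin n) => p.1.1 ∘ p.2 := by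
  rintro ⟨⟨x, hx⟩, σ⟩ ⟨⟨y, hy⟩, τ⟩ h
  simp only at h
  have hxy : x = y := by
    refine (hx.range_inj hy).1 ?_
    rw [← σ.surjective.range_comp x, ← τ.surjective.range_comp y, h]
  subst hxy
  have : σ = τ := Equiv.ext fun i => hx.injective (congrFun h i)
  rw [this]

theorem injective_mem_range_weylChamber_comp_perm {y : Fin n → I} (hy : Function.Injective y) :
    y ∈ range fun p : WeylChamber I n × Equiv.Perm (Fin n) => p.1.1 ∘ p.2 := by
  refine ⟨⟨⟨y ∘ Tuple.sort y, ?_⟩, (Tuple.sort y)⁻¹⟩, ?_⟩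
  · exact (Tuple.monotone_sort y).strictMono_of_injective (hy.comp (Tuple.sort y).injective)
  · funext i
    simp

/-- Andréief's identity (the continuous Cauchy--Binet formula) on the discrete Weyl chamber. -/
theorem hasSum_det_mul_det (α : Fin n → I → ℝ) (β : I → Fin n → ℝ)
    (h : ∀ i k, Summable fun z => α i z * β z k) :
    HasSum (fun y : WeylChamber I n => (Matrix.of fun i j => α i (y.1 j)).det *
        (Matrix.of fun j k => β (y.1 j) k).det)
      (Matrix.of fun i k => ∑' z, α i z * β z k).det := by
  have hdet : ∀ M : Matrix (Fin n) (Fin n) ℝ,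
      M.det = ∑ σ : Equiv.Perm (Fin n), ((σ.sign : ℤ) : ℝ) * ∏ i, M i (σ i) := fun M => by
    rw [← Matrix.det_transpose, Matrix.det_apply']
    rfl
  -- Over all of `I^n` only the `β` determinant is expanded; each term is then a product of
  -- one-variable sums. Tuples with a repeated entry contribute zero, and summing over the orderings
  -- of a chamber point rebuilds the `α` determinant.
  have h1 : HasSum (fun y : Fin n → I => (∏ i, α i (y i)) * (Matrix.of fun i k => β (y i) k).det)
      (Matrix.of fun i k => ∑' z, α i z * β z k).det := by
    simp only [hdet, Matrix.of_apply, Finset.mul_sum]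
    refine hasSum_sum fun σ _ => ?_
    refine ((hasSum_prod_pi fun i => h i (σ i)).mul_left
      ((σ.sign : ℤ) : ℝ)).congr_fun fun y => ?_
    rw [Finset.prod_mul_distrib]
    ring
  rw [← weylChamber_comp_perm_injective.hasSum_iff] at h1
  · refine h1.prod_fiberwise fun y => ?_
    convert hasSum_fintype _ using 1
    rw [hdet, Finset.sum_mul]
    refine Finset.sum_congr rfl fun τ _ => ?_
    have h2 := Matrix.det_permute τ (Matrix.of fun j k => β (y.1 j) k)
    simp only [Function.comp_apply, Matrix.of_apply]
    rw [show (Matrix.of fun i k => β (y.1 (τ i)) k) =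
      (Matrix.of fun j k => β (y.1 j) k).submatrix τ id from rfl, h2]
    ring
  · intro y hy
    have hy' : ¬Function.Injective y := fun hinj =>
      hy (injective_mem_range_weylChamber_comp_perm hinj)
    simp only [Function.Injective, not_forall] at hy'
    obtain ⟨i, j, hij, hne⟩ := hy'
    rw [Matrix.det_zero_of_row_eq hne, mul_zero]
    funext k
    simp [hij]

theorem summable_abs_det_mul_prod (α : Fin n → I → ℝ) (w : I → ℝ) (hw : ∀ z, 0 ≤ w z)
    (h : ∀ i, Summable fun z => α i z * w z) :
    Summable fun y : WeylChamber I n =>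
      |(Matrix.of fun i j => α i (y.1 j)).det| * ∏ j, w (y.1 j) := by
  have h1 : ∀ σ : Equiv.Perm (Fin n),
      Summable fun y : WeylChamber I n => ∏ i, |α (σ i) (y.1 i) * w (y.1 i)| := fun σ =>
    (hasSum_prod_pi fun i => (h (σ i)).abs).summable.comp_injective Subtype.val_injective
  refine Summable.of_nonneg_of_le (fun y => mul_nonneg (abs_nonneg _)
    (Finset.prod_nonneg fun j _ => hw _)) (fun y => ?_) (summable_sum (s := Finset.univ) fun σ _ => h1 σ)
  rw [Matrix.det_apply']
  calc _ ≤ (∑ σ : Equiv.Perm (Fin n), ∏ i, |α (σ i) (y.1 i)|) * ∏ j, w (y.1 j) := by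
        refine mul_le_mul_of_nonneg_right ?_ (Finset.prod_nonneg fun j _ => hw _)
        refine (Finset.abs_sum_le_sum_abs _ _).trans (Finset.sum_le_sum fun σ _ => ?_)
        rw [abs_mul, Finset.abs_prod]
        rcases Int.units_eq_one_or σ.sign with hs | hs <;> simp [hs]
    _ = _ := by
        rw [Finset.sum_mul]
        refine Finset.sum_congr rfl fun σ _ => ?_
        rw [← Finset.prod_mul_distrib]
        exact Finset.prod_congr rfl fun i _ => by rw [abs_mul, abs_of_nonneg (hw _)]

end Andreief

/-! ### Interlacing as a determinant and as a box. -/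

section Interlacing

variable {I : Set ℤ} {n : ℕ}

/-- Subtracting from each row its predecessor clears the first column below its top entry, along
which the determinant is then expanded. -/
theorem det_ones_column (G : Fin (n + 1) → Fin n → ℝ) :
    (Matrix.of fun i => (Fin.cons 1 (G i) : Fin (n + 1) → ℝ)).det =
      (Matrix.of fun i j : Fin n => G i.succ j - G i.castSucc j).det := by
  set B : Matrix (Fin (n + 1)) (Fin (n + 1)) ℝ := Matrix.of
    (Fin.cons (Fin.cons 1 (G 0)) fun i => Fin.cons 0 fun j => G i.succ j - G i.castSucc j) with hB
  rw [Matrix.det_eq_of_forall_row_eq_smul_add_pred (B := B) (fun _ => 1)]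
  · rw [Matrix.det_succ_column_zero, Fin.sum_univ_succ]
    simp only [hB, Matrix.of_apply, Fin.cons_zero, Fin.cons_succ, mul_zero, zero_mul,
      Finset.sum_const_zero, add_zero, Fin.val_zero, pow_zero, one_mul]
    rfl
  · intro j
    simp [hB]
  · intro i j
    refine Fin.cases ?_ (fun j => ?_) j <;> simp [hB]

-- The entry `(i, j)` tests whether `y_j` lies in `[x_i, x_{i+1})`. These intervals are disjoint and
-- ordered and `y` is increasing, so a permutation with a nonzero term is monotone, hence the
-- identity.
open Classical in
theorem det_indicator_sub_eq (x : WeylChamber I (n + 1)) (y : WeylChamber I n) :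
    (Matrix.of fun i j : Fin n => (Ioi (y.1 j)).indicator (1 : I → ℝ) (x.1 i.succ) -
      (Ioi (y.1 j)).indicator (1 : I → ℝ) (x.1 i.castSucc)).det =
      if Interlaces x y then 1 else 0 := by
  have hent : ∀ i j : Fin n, (Ioi (y.1 j)).indicator (1 : I → ℝ) (x.1 i.succ) -
      (Ioi (y.1 j)).indicator (1 : I → ℝ) (x.1 i.castSucc) =
      if x.1 i.castSucc ≤ y.1 j ∧ y.1 j < x.1 i.succ then 1 else 0 := by
    intro i j
    have hx : x.1 i.castSucc < x.1 i.succ := x.2 Fin.castSucc_lt_succ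
    simp only [indicator, mem_Ioi, Pi.one_apply]
    by_cases h1 : y.1 j < x.1 i.castSucc
    · simp [h1, h1.trans hx, h1.not_ge]
    · by_cases h2 : y.1 j < x.1 i.succ <;> simp [h1, h2, not_lt.1 h1]
  rw [Matrix.det_apply', Finset.sum_eq_single 1]
  · simp only [hent, Matrix.of_apply, Equiv.Perm.sign_one, Equiv.Perm.coe_one, id, Units.val_one,
      Int.cast_one, one_mul, Finset.prod_ite_zero, Finset.prod_const_one, Finset.mem_univ,
      forall_const, Interlaces]
    congr
  · intro σ _ hσ
    by_contra hne
    have hprod := right_ne_zero_of_mul hne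
    rw [Finset.prod_ne_zero_iff] at hprod
    have hmem : ∀ i, x.1 (σ i).castSucc ≤ y.1 i ∧ y.1 i < x.1 (σ i).succ := by
      intro i
      have := hprod i (Finset.mem_univ i)
      rw [Matrix.of_apply, hent] at this
      by_contra hcon
      exact this (if_neg hcon)
    have hmono : Monotone σ := by
      intro i j hij
      by_contra! hlt
      have h1 : x.1 (σ j).succ ≤ x.1 (σ i).castSucc := x.2.monotone (Fin.succ_le_castSucc_iff.2 hlt)
      exact absurd ((hmem j).2.trans_le (h1.trans (hmem i).1)) (not_lt.2 (y.2.monotone hij))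
    refine hσ (Equiv.ext fun i => ?_)
    have hs : StrictMono σ := hmono.strictMono_of_injective σ.injective
    have hid : (σ : Fin n → Fin n) = id := by
      refine (hs.range_inj strictMono_id).1 ?_
      rw [σ.surjective.range_eq, range_id]
    exact congrFun hid i
  · simp

open Classical in
/-- The box of all points that interlace with `x`. -/
noncomputable def interlacingBox (x : WeylChamber I (n + 1)) : Finset (Fin n → I) :=
  Fintype.piFinset fun i => Finset.Ico (x.1 i.castSucc) (x.1 i.succ)

theorem mem_interlacingBox {x : WeylChamber I (n + 1)} {z : Fin n → I} :
    z ∈ interlacingBox x ↔ ∀ i, x.1 i.castSucc ≤ z i ∧ z i < x.1 i.succ := by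
  simp [interlacingBox]

/-- Consecutive half-open intervals do not overlap. The interlacing set is therefore a full product,
the form that multilinear expansion of a determinant produces. -/
theorem strictMono_of_mem_interlacingBox {x : WeylChamber I (n + 1)} {z : Fin n → I}
    (hz : z ∈ interlacingBox x) : StrictMono z := by
  rw [mem_interlacingBox] at hz
  intro i j hij
  exact (hz i).2.trans_le ((x.2.monotone (Fin.succ_le_castSucc_iff.2 hij)).trans (hz j).1)

/-- The points interlacing with `x` are the points of the box of `x`. -/
noncomputable def interlacesEquiv (x : WeylChamber I (n + 1)) :
    {y : WeylChamber I n // Interlaces x y} ≃ interlacingBox x where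
  toFun y := ⟨y.1.1, mem_interlacingBox.2 y.2⟩
  invFun z := ⟨⟨z.1, strictMono_of_mem_interlacingBox z.2⟩, mem_interlacingBox.1 z.2⟩
  left_inv _ := rfl
  right_inv _ := rfl

instance (x : WeylChamber I (n + 1)) : Finite {y : WeylChamber I n // Interlaces x y} :=
  Finite.of_equiv _ (interlacesEquiv x).symm

theorem tsum_interlaces (x : WeylChamber I (n + 1)) (G : (Fin n → I) → ℝ) :
    ∑' y : {y : WeylChamber I n // Interlaces x y}, G y.1.1 = ∑ z ∈ interlacingBox x, G z := by
  rw [← Finset.tsum_subtype, ← (interlacesEquiv x).tsum_eq]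
  rfl

open Classical in
theorem sum_Ico_upNeighbor_sub (hsucc : ∀ x ∈ I, x + 1 ∈ I) (F : I → ℝ) {u v : I} (huv : u ≤ v) :
    ∑ z ∈ Finset.Ico u v, (F (upNeighbor z) - F z) = F v - F u := by
  obtain ⟨m, hm⟩ := Int.le.dest (show (u : ℤ) ≤ v from huv)
  induction m generalizing v with
  | zero =>
    have : u = v := Subtype.ext (by simpa using hm)
    simp [this]
  | succ m ih =>
    have hmem : ∀ k : ℕ, (u : ℤ) + k ∈ I := by
      intro k
      induction k with
      | zero => simp
      | succ k ihk =>
        push_cast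
        rw [← add_assoc]
        exact hsucc _ ihk
    set v₀ : I := ⟨u + m, hmem m⟩ with hv₀
    have hv : upNeighbor v₀ = v := by
      refine Subtype.ext ?_
      rw [upNeighbor, dif_pos (hsucc _ v₀.2), ← hm]
      simp only [hv₀]
      push_cast
      ring
    have huv₀ : u ≤ v₀ := by
      rw [← Subtype.coe_le_coe]
      simp [hv₀]
    have hins : Finset.Ico u v = insert v₀ (Finset.Ico u v₀) := by
      ext z
      have h1 : (v₀ : ℤ) = u + m := rfl
      simp only [Finset.mem_Ico, Finset.mem_insert, ← Subtype.coe_le_coe, ← Subtype.coe_lt_coe,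
        ← Subtype.coe_inj, h1, ← hm]
      push_cast
      omega
    rw [hins, Finset.sum_insert (by simp), ih huv₀ rfl, hv]
    ring

end Interlacing

/-! ### Polynomial growth on the Weyl chamber and absolute convergence. -/

section Growth

variable {I : Set ℤ} {n : ℕ}

/-- The product weight `∏ i, (1 + x_i ^ 2)` on the Weyl chamber. -/
noncomputable def chamberWeight (x : WeylChamber I n) : ℝ := ∏ i, polyWeight 1 (x.1 i)

theorem one_le_chamberWeight (x : WeylChamber I n) : 1 ≤ chamberWeight x :=
  Finset.prod_induction _ (1 ≤ ·) (fun _ _ => one_le_mul_of_one_le_of_one_le) le_rfl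
    fun i _ => one_le_polyWeight 1 (x.1 i)

theorem polyWeight_le_chamberWeight (x : WeylChamber I n) (i : Fin n) :
    polyWeight 1 (x.1 i) ≤ chamberWeight x := by
  unfold chamberWeight
  rw [← Finset.mul_prod_erase _ _ (Finset.mem_univ i)]
  exact le_mul_of_one_le_right (polyWeight_pos _ _).le
    (Finset.prod_induction _ (1 ≤ ·) (fun _ _ => one_le_mul_of_one_le_of_one_le) le_rfl
      fun j _ => one_le_polyWeight 1 (x.1 j))

/-- Functions on the Weyl chamber of polynomial growth. -/
def PolyGrowth (g : WeylChamber I n → ℝ) : Prop :=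
  ∃ (N : ℕ) (M : ℝ), ∀ x, |g x| ≤ M * chamberWeight x ^ N

theorem sub_le_polyWeight_mul (x y : I) :
    |((x : ℤ) : ℝ) - ((y : ℤ) : ℝ)| ≤ polyWeight 1 x * polyWeight 1 y := by
  unfold polyWeight
  set u := ((x : ℤ) : ℝ)
  set v := ((y : ℤ) : ℝ)
  rw [abs_le, mul_one]
  constructor <;> nlinarith [sq_nonneg (u * v), sq_nonneg (u - 1), sq_nonneg (v - 1),
    sq_nonneg (u + 1), sq_nonneg (v + 1)]

theorem vdm_pos (x : WeylChamber I n) : 0 < vdm x :=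
  Finset.prod_pos fun i _ => Finset.prod_pos fun j hj => by
    rw [sub_pos]
    exact_mod_cast x.2 (Finset.mem_Ioi.1 hj)

theorem polyGrowth_vdm : PolyGrowth (vdm : WeylChamber I n → ℝ) := by
  refine ⟨∑ i : Fin n, ∑ j ∈ Finset.Ioi i, 2, 1, fun x => ?_⟩
  rw [one_mul, vdm, Finset.abs_prod, ← Finset.prod_pow_eq_pow_sum]
  refine Finset.prod_le_prod (fun i _ => abs_nonneg _) fun i _ => ?_
  rw [Finset.abs_prod, ← Finset.prod_pow_eq_pow_sum]
  refine Finset.prod_le_prod (fun j _ => abs_nonneg _) fun j _ => ?_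
  refine (sub_le_polyWeight_mul _ _).trans ?_
  rw [sq]
  exact mul_le_mul (polyWeight_le_chamberWeight x j) (polyWeight_le_chamberWeight x i)
    (polyWeight_pos _ _).le (zero_le_one.trans (one_le_chamberWeight x))

theorem PolyGrowth.mul_bounded {g f : WeylChamber I n → ℝ} (hg : PolyGrowth g) {B : ℝ}
    (hf : ∀ x, |f x| ≤ B) : PolyGrowth fun x => g x * f x := by
  obtain ⟨N, M, hM⟩ := hg
  refine ⟨N, M * B, fun x => ?_⟩
  rw [abs_mul, mul_right_comm]
  exact mul_le_mul (hM x) (hf x) (abs_nonneg _) ((abs_nonneg _).trans (hM x))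

/-- The unnormalized Vandermonde link. -/
noncomputable def interlacingSum (g : WeylChamber I n → ℝ) (x : WeylChamber I (n + 1)) : ℝ :=
  ∑' y : {y : WeylChamber I n // Interlaces x y}, g y.1

/-- From `u ≤ w ≤ v` one gets `1 + w² ≤ (1 + u²)(1 + v²)`; over all `i`, each `x` coordinate occurs
at most twice. -/
theorem chamberWeight_le_of_interlaces {x : WeylChamber I (n + 1)} {y : WeylChamber I n}
    (h : Interlaces x y) : chamberWeight y ≤ chamberWeight x ^ 2 := by
  calc chamberWeight y ≤ ∏ i : Fin n, polyWeight 1 (x.1 i.castSucc) * polyWeight 1 (x.1 i.succ) := by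
        refine Finset.prod_le_prod (fun i _ => (polyWeight_pos _ _).le) fun i _ => ?_
        have h1 : ((x.1 i.castSucc : ℤ) : ℝ) ≤ ((y.1 i : ℤ) : ℝ) := by exact_mod_cast (h i).1
        have h2 : ((y.1 i : ℤ) : ℝ) ≤ ((x.1 i.succ : ℤ) : ℝ) := by exact_mod_cast (h i).2.le
        unfold polyWeight
        set u := ((x.1 i.castSucc : ℤ) : ℝ)
        set v := ((x.1 i.succ : ℤ) : ℝ)
        set w := ((y.1 i : ℤ) : ℝ)
        have h3 : w ^ 2 ≤ u ^ 2 + v ^ 2 := by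
          rcases le_total 0 w with hw | hw <;> nlinarith [sq_nonneg u, sq_nonneg v]
        simp only [mul_one]
        nlinarith [mul_nonneg (sq_nonneg u) (sq_nonneg v)]
    _ = (∏ i : Fin n, polyWeight 1 (x.1 i.castSucc)) * ∏ i : Fin n, polyWeight 1 (x.1 i.succ) :=
        Finset.prod_mul_distrib
    _ ≤ chamberWeight x * chamberWeight x := by
        refine mul_le_mul ?_ ?_ (Finset.prod_nonneg fun i _ => (polyWeight_pos _ _).le)
          (zero_le_one.trans (one_le_chamberWeight x))
        · rw [chamberWeight, Fin.prod_univ_castSucc]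
          exact le_mul_of_one_le_right (Finset.prod_nonneg fun i _ => (polyWeight_pos _ _).le)
            (one_le_polyWeight _ _)
        · rw [chamberWeight, Fin.prod_univ_succ]
          exact le_mul_of_one_le_left (Finset.prod_nonneg fun i _ => (polyWeight_pos _ _).le)
            (one_le_polyWeight _ _)
    _ = chamberWeight x ^ 2 := (sq _).symm

theorem card_interlacingBox_le (x : WeylChamber I (n + 1)) :
    ((interlacingBox x).card : ℝ) ≤ chamberWeight x ^ (2 * n) := by
  classical
  rw [interlacingBox, Fintype.card_piFinset, Nat.cast_prod, pow_mul]
  calc _ ≤ ∏ _i : Fin n, chamberWeight x ^ 2 := by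
        refine Finset.prod_le_prod (fun i _ => Nat.cast_nonneg _) fun i _ => ?_
        refine le_trans ?_ ((sub_le_polyWeight_mul (x.1 i.succ) (x.1 i.castSucc)).trans ?_)
        · have h1 : (Finset.Ico (x.1 i.castSucc) (x.1 i.succ)).card ≤
              (Finset.Ico (x.1 i.castSucc : ℤ) (x.1 i.succ : ℤ)).card :=
            Finset.card_le_card_of_injOn Subtype.val (fun z hz => by simpa using hz)
              Subtype.val_injective.injOn
          rw [Int.card_Ico] at h1
          have hlt : (x.1 i.castSucc : ℤ) < x.1 i.succ := x.2 Fin.castSucc_lt_succ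
          have h2 : (((Finset.Ico (x.1 i.castSucc) (x.1 i.succ)).card : ℤ) : ℝ) ≤
              (((x.1 i.succ : ℤ) - (x.1 i.castSucc : ℤ) : ℤ) : ℝ) := by
            rw [Int.cast_le]
            omega
          push_cast at h2
          exact h2.trans (le_abs_self _)
        · rw [sq]
          exact mul_le_mul (polyWeight_le_chamberWeight x _) (polyWeight_le_chamberWeight x _)
            (polyWeight_pos _ _).le (zero_le_one.trans (one_le_chamberWeight x))
    _ = _ := by simp

/-- Both the number of interlacing points and the weight at each of them are bounded by powers of
the weight of `x`. -/
theorem PolyGrowth.interlacingSum {g : WeylChamber I n → ℝ} (hg : PolyGrowth g) :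
    PolyGrowth (interlacingSum fun y => |g y|) := by
  obtain ⟨N, M, hM⟩ := hg
  refine ⟨2 * n + 2 * N, |M|, fun x => ?_⟩
  have hx := one_le_chamberWeight x
  have hpt : ∀ y : {y : WeylChamber I n // Interlaces x y},
      |g y.1| ≤ |M| * chamberWeight x ^ (2 * N) := by
    intro y
    refine (hM y.1).trans (mul_le_mul (le_abs_self M) ?_ ?_ (abs_nonneg M))
    · rw [pow_mul]
      exact pow_le_pow_left₀ (zero_le_one.trans (one_le_chamberWeight y.1))
        (chamberWeight_le_of_interlaces y.2) N
    · exact pow_nonneg (zero_le_one.trans (one_le_chamberWeight y.1)) N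
  rw [_root_.interlacingSum, abs_of_nonneg (tsum_nonneg fun y => abs_nonneg _)]
  calc _ ≤ ∑' _y : {y : WeylChamber I n // Interlaces x y}, |M| * chamberWeight x ^ (2 * N) :=
        Summable.tsum_le_tsum hpt (Summable.of_finite) (Summable.of_finite)
    _ = (interlacingBox x).card * (|M| * chamberWeight x ^ (2 * N)) := by
        rw [tsum_interlaces x fun _ => |M| * chamberWeight x ^ (2 * N), Finset.sum_const,
          nsmul_eq_mul]
    _ ≤ chamberWeight x ^ (2 * n) * (|M| * chamberWeight x ^ (2 * N)) :=
        mul_le_mul_of_nonneg_right (card_interlacingBox_le x) (by positivity)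
    _ = _ := by ring

variable {lam mu : ℤ → ℝ}

theorem summable_karlinMcGregor_mul (hP : PolyBirthDeath I lam mu) {t : ℝ} (ht : 0 ≤ t)
    (x : WeylChamber I n) {g : WeylChamber I n → ℝ} (hg : PolyGrowth g) :
    Summable fun y => |karlinMcGregor (birthDeathMatrix I lam mu) n t x y| * g y := by
  obtain ⟨N, M, hM⟩ := hg
  have h1 := summable_abs_det_mul_prod
    (fun i => transitionDensity (birthDeathMatrix I lam mu) t (x.1 i))
    (fun z => polyWeight 1 z ^ N) (fun z => pow_nonneg (polyWeight_pos 1 z).le N) fun i =>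
      hP.summable_transitionDensity_mul ht (x.1 i) (k := N) (M := 2 ^ (N - 1) * 2) fun z => by
        rw [abs_of_nonneg (pow_nonneg (polyWeight_pos 1 z).le N), polyWeight, polyWeight, mul_one]
        refine (add_pow_le zero_le_one (sq_nonneg _) N).trans ?_
        rw [one_pow, ← pow_mul, mul_assoc]
        have : 0 ≤ ((z : ℤ) : ℝ) ^ (2 * N) := (even_two_mul N).pow_nonneg _
        gcongr
        linarith
  refine Summable.of_norm_bounded (h1.mul_left M) fun y => ?_
  rw [norm_mul, Real.norm_eq_abs, Real.norm_eq_abs, abs_abs, Finset.prod_pow, mul_left_comm]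
  exact mul_le_mul_of_nonneg_left (hM y) (abs_nonneg _)

theorem summable_karlinMcGregor_mul' (hP : PolyBirthDeath I lam mu) {t : ℝ} (ht : 0 ≤ t)
    (x : WeylChamber I n) {g : WeylChamber I n → ℝ} (hg : PolyGrowth g) :
    Summable fun y => karlinMcGregor (birthDeathMatrix I lam mu) n t x y * g y := by
  refine Summable.of_norm ((summable_karlinMcGregor_mul hP ht x hg).norm.congr fun y => ?_)
  rw [norm_mul, norm_mul, norm_abs_eq_norm]

end Growth

/-! ### Eigenfunctions and intertwining of the Karlin–McGregor kernels. -/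

section Intertwining

variable {I : Set ℤ} {n : ℕ}

/-- Non-explosion: the constant `1` also solves the backward equation, so uniqueness shows that no
mass is lost. -/
theorem transitionSemigroup_one {lam mu : ℤ → ℝ} (hP : PolyBirthDeath I lam mu) {t : ℝ}
    (ht : 0 ≤ t) (x : I) :
    transitionSemigroup (birthDeathMatrix I lam mu) (fun _ => 1) t x = 1 := by
  obtain ⟨h1, h2⟩ := hP.isBackwardSolution (h := fun _ => (1 : ℝ)) (k := 0) (M := 1) fun y => by
    rw [abs_one, one_mul]
    exact one_le_polyWeight 0 y
  refine h1.eq_of_initial_eq (v := fun _ _ => 1) hP ⟨fun y => continuousOn_const, fun y s _ => ?_,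
    fun T => ⟨0, 1, fun s _ y => ?_⟩⟩ (fun y => h2 y) ht x
  · simpa [birthDeathGen] using hasDerivAt_const s (1 : ℝ)
  · rw [abs_one, one_mul]
    exact one_le_polyWeight 0 y

/-- Andréief's identity with the monomials as second family, whose determinant is the Vandermonde
determinant. -/
theorem hasSum_karlinMcGregor_mul_vdm {a b c b' c' : ℝ}
    (hP : PolyBirthDeath I (quadRate a b c) (quadRate a b' c')) {t : ℝ} (ht : 0 ≤ t)
    (x : WeylChamber I n) :
    HasSum (fun y => karlinMcGregor
        (birthDeathMatrix I (quadRate a b c) (quadRate a b' c')) n t x y * vdm y)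
      (Real.exp (vdmEigenvalue a b b' n * t) * vdm x) := by
  have h := hasSum_det_mul_det
    (fun i => transitionDensity (birthDeathMatrix I (quadRate a b c) (quadRate a b' c')) t (x.1 i))
    (fun z (k : Fin n) => ((z : ℤ) : ℝ) ^ (k : ℕ)) fun i k =>
      hP.summable_transitionDensity_mul ht (x.1 i) (k := k) (M := 1) fun y => by
        rw [one_mul]
        exact abs_pow_le_polyWeight (by omega) y
  rw [← det_transitionSemigroup_pow hP ht x]
  refine h.congr_fun fun y => ?_
  rw [karlinMcGregor, vdm, ← Matrix.det_vandermonde fun i => ((y.1 i : ℤ) : ℝ)]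
  rfl

open Classical in
/-- Intertwining of the Karlin--McGregor kernels by the interlacing relation. -/
theorem hasSum_karlinMcGregor_interlaces {lam mu lamS : ℤ → ℝ} {r : ℝ}
    (hP : PolyBirthDeath I lam mu) (hS : PolyBirthDeath I lamS mu)
    (hlamS : ∀ x, lamS x = lam (x + 1))
    (hr : ∀ x, lam (x + 1) - lam x - mu (x + 1) + mu x = r) {t : ℝ} (ht : 0 ≤ t)
    (x : WeylChamber I (n + 1)) (y : WeylChamber I n) :
    HasSum (fun x' => karlinMcGregor (birthDeathMatrix I lam mu) (n + 1) t x x' *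
        if Interlaces x' y then 1 else 0)
      (Real.exp (r * n * t) *
        interlacingSum (fun z => karlinMcGregor (birthDeathMatrix I lamS mu) n t z y) x) := by
  set p := transitionDensity (birthDeathMatrix I lam mu) t
  set q := transitionDensity (birthDeathMatrix I lamS mu) t
  set F : Fin n → I → ℝ := fun j =>
    transitionSemigroup (birthDeathMatrix I lam mu) ((Ioi (y.1 j)).indicator 1) t
  set β : I → Fin (n + 1) → ℝ := fun z =>
    Fin.cons 1 fun j => (Ioi (y.1 j)).indicator (1 : I → ℝ) z with hβ
  -- The constant function is added to the `n` tail indicators to make the determinant square of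
  -- size `n + 1`.
  have h := hasSum_det_mul_det (fun i => p (x.1 i)) β fun i k => by
    refine hP.summable_transitionDensity_mul ht (x.1 i) (k := 0) (M := 1) fun z => ?_
    refine Fin.cases ?_ (fun j => ?_) k
    · simp only [hβ, Fin.cons_zero, abs_one, one_mul]
      exact one_le_polyWeight 0 z
    · simp only [hβ, Fin.cons_succ]
      exact abs_indicator_one_le_polyWeight _ z
  have hsum : (fun i k => ∑' z, p (x.1 i) z * β z k) =
      fun i => (Fin.cons 1 fun j => F j (x.1 i) : Fin (n + 1) → ℝ) := by
    funext i k
    refine Fin.cases ?_ (fun j => ?_) k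
    · simp only [hβ, Fin.cons_zero]
      exact transitionSemigroup_one hP ht (x.1 i)
    · simp only [hβ, Fin.cons_succ]
      rfl
  -- The increment of the tail between `x_i` and `x_{i+1}` telescopes into unit steps, each given by
  -- the duality.
  have hF : ∀ i j : Fin n, F j (x.1 i.succ) - F j (x.1 i.castSucc) =
      Real.exp (r * t) * ∑ z ∈ Finset.Ico (x.1 i.castSucc) (x.1 i.succ), q z (y.1 j) := by
    intro i j
    rw [← sum_Ico_upNeighbor_sub hP.succ_mem (F j) (x.2 Fin.castSucc_lt_succ).le, Finset.mul_sum]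
    exact Finset.sum_congr rfl fun z _ => tail_transitionSemigroup_sub hP hS hlamS hr ht (y.1 j) z
  have hdet : (Matrix.of fun i j : Fin n => F j (x.1 i.succ) - F j (x.1 i.castSucc)).det =
      Real.exp (r * n * t) *
        interlacingSum (fun z => karlinMcGregor (birthDeathMatrix I lamS mu) n t z y) x := by
    have h1 : (Matrix.of fun i j : Fin n => F j (x.1 i.succ) - F j (x.1 i.castSucc)) =
        Real.exp (r * t) • Matrix.of fun i : Fin n =>
          ∑ z ∈ Finset.Ico (x.1 i.castSucc) (x.1 i.succ), fun j => q z (y.1 j) := by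
      ext i j
      rw [Matrix.smul_apply, Matrix.of_apply, Matrix.of_apply, Finset.sum_apply, hF, smul_eq_mul]
    rw [h1, Matrix.det_smul, Fintype.card_fin, ← Real.exp_nat_mul,
      show (n : ℝ) * (r * t) = r * n * t by ring]
    congr 1
    -- Each row is a sum over `[x_i, x_{i+1})`; multilinearity turns the determinant into a sum over
    -- the box of points interlacing with `x`.
    have h2 := (Matrix.detRowAlternating (R := ℝ) (n := Fin n)).toMultilinearMap.map_sum_finset
      (fun (_ : Fin n) (z : I) (j : Fin n) => q z (y.1 j))
      (fun i => Finset.Ico (x.1 i.castSucc) (x.1 i.succ))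
    refine Eq.trans h2 ?_
    exact (tsum_interlaces x fun z => (Matrix.of fun i j => q (z i) (y.1 j)).det).symm
  rw [show (Matrix.of fun i k => ∑' z, p (x.1 i) z * β z k) =
    Matrix.of (fun i k => ∑' z, p (x.1 i) z * β z k) from rfl, hsum, det_ones_column, hdet] at h
  refine h.congr_fun fun x' => ?_
  rw [← det_indicator_sub_eq x' y, ← det_ones_column fun i j =>
    (Ioi (y.1 j)).indicator (1 : I → ℝ) (x'.1 i)]
  rfl

/-- The kernel identity for each fixed `y` is integrated against `g`, with the sums over `x'` and
`y` exchanged by Fubini. -/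
theorem tsum_karlinMcGregor_mul_interlacingSum {lam mu lamS : ℤ → ℝ} {r : ℝ}
    (hP : PolyBirthDeath I lam mu) (hS : PolyBirthDeath I lamS mu)
    (hlamS : ∀ x, lamS x = lam (x + 1))
    (hr : ∀ x, lam (x + 1) - lam x - mu (x + 1) + mu x = r) {t : ℝ} (ht : 0 ≤ t)
    {g : WeylChamber I n → ℝ} (hg : PolyGrowth g) (x : WeylChamber I (n + 1)) :
    ∑' x', karlinMcGregor (birthDeathMatrix I lam mu) (n + 1) t x x' * interlacingSum g x' =
      Real.exp (r * n * t) * interlacingSum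
        (fun z => ∑' y, karlinMcGregor (birthDeathMatrix I lamS mu) n t z y * g y) x := by
  classical
  set K := karlinMcGregor (birthDeathMatrix I lam mu) (n + 1) t x
  have hind : ∀ (f : WeylChamber I n → ℝ) (x' : WeylChamber I (n + 1)),
      HasSum (fun y => if Interlaces x' y then f y else 0) (interlacingSum f x') := by
    intro f x'
    have h1 : Summable fun y : {y : WeylChamber I n // Interlaces x' y} => f y.1 :=
      Summable.of_finite
    have h2 := (hasSum_subtype_iff_indicator (s := {y | Interlaces x' y})).1 h1.hasSum
    refine h2.congr_fun fun y => ?_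
    simp [indicator]
  -- Absolute values replace any appeal to positivity of the kernel: the inner sum of `|g|` over
  -- interlacing points still grows polynomially.
  have habs : Summable fun p : WeylChamber I (n + 1) × WeylChamber I n =>
      K p.1 * if Interlaces p.1 p.2 then g p.2 else 0 := by
    refine Summable.of_norm ((summable_prod_of_nonneg fun p => norm_nonneg _).2 ?_)
    have h1 : ∀ x', HasSum (fun y => ‖K x' * if Interlaces x' y then g y else 0‖)
        (|K x'| * interlacingSum (fun y => |g y|) x') := by
      intro x'
      refine ((hind (fun y => |g y|) x').mul_left |K x'|).congr_fun fun y => ?_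
      rw [norm_mul, Real.norm_eq_abs, Real.norm_eq_abs, apply_ite abs, abs_zero]
    refine ⟨fun x' => (h1 x').summable, ?_⟩
    simp only [(h1 _).tsum_eq]
    exact summable_karlinMcGregor_mul hP ht x hg.interlacingSum
  calc _ = ∑' x', ∑' y, K x' * (if Interlaces x' y then g y else 0) :=
        tsum_congr fun x' => by rw [tsum_mul_left, (hind g x').tsum_eq]
    _ = ∑' y, ∑' x', K x' * (if Interlaces x' y then g y else 0) := habs.tsum_comm.symm
    _ = ∑' y, Real.exp (r * n * t) * interlacingSum
          (fun z => karlinMcGregor (birthDeathMatrix I lamS mu) n t z y * g y) x := by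
        refine tsum_congr fun y => ?_
        have h1 := (hasSum_karlinMcGregor_interlaces hP hS hlamS hr ht x y).mul_right (g y)
        have h2 : interlacingSum
            (fun z => karlinMcGregor (birthDeathMatrix I lamS mu) n t z y * g y) x =
            interlacingSum (fun z => karlinMcGregor (birthDeathMatrix I lamS mu) n t z y) x * g y :=
          tsum_mul_right
        rw [h2, ← mul_assoc, ← h1.tsum_eq]
        refine tsum_congr fun x' => ?_
        rw [mul_assoc, ite_mul, one_mul, zero_mul]
    _ = _ := by
        rw [tsum_mul_left]
        congr 1
        simp only [interlacingSum]
        have := Fintype.ofFinite {z : WeylChamber I n // Interlaces x z}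
        simp only [tsum_fintype]
        exact Summable.tsum_finsetSum fun z _ => summable_karlinMcGregor_mul' hS ht z.1 hg

end Intertwining

/-! ### Matching of the eigenvalues and conclusion. -/

theorem vdmEigenvalue_succ (a b b' : ℝ) (n : ℕ) :
    vdmEigenvalue a b b' (n + 1) = vdmEigenvalue a (b + 2 * a) b' n + (b - b') * n := by
  unfold vdmEigenvalue
  push_cast
  ring

theorem mainTheorem7 (I : Set ℤ) (a b c b' c' : ℝ) (lam mu lamTilde : ℤ → ℝ)
    (D DTilde : Matrix I I ℝ)
    (hlam : lam = quadRate a b c) (hmu : mu = quadRate a b' c')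
    -- the birth rate of the shifted chain, `lam (x + 1) = a x² + (b + 2a) x + (a + b + c)`
    (hlamTilde : lamTilde = fun x => lam (x + 1))
    (hD : D = birthDeathMatrix I lam mu) (hDTilde : DTilde = birthDeathMatrix I lamTilde mu)
    (hbirth : ∀ x ∈ I, 0 < lam x)
    -- birth and death chain on `ℕ`, reflecting at the origin, or bilateral chain on `ℤ`
    (hdeath : (I = Set.Ici 0 ∧ mu 0 = 0 ∧ ∀ x ∈ I, x ≠ 0 → 0 < mu x) ∨
      (I = Set.univ ∧ ∀ x ∈ I, 0 < mu x))
    (n : ℕ) (hn : 1 ≤ n) :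
    IsPositiveEigenfunction (karlinMcGregor D (n + 1)) vdm (vdmEigenvalue a b b' (n + 1)) ∧
    IsPositiveEigenfunction (karlinMcGregor DTilde n) vdm (vdmEigenvalue a (b + 2 * a) b' n) ∧
    ∀ (f : ZeroAtInftyContinuousMap (WeylChamber I n) ℝ) (t : ℝ), 0 ≤ t →
      (∀ x, Summable fun y => karlinMcGregor D (n + 1) t x y * (vdm y * vandermondeLink f y)) ∧
      (∀ x, Summable fun y => karlinMcGregor DTilde n t x y * (vdm y * f y)) ∧
      doobTransform (karlinMcGregor D (n + 1)) vdm (vdmEigenvalue a b b' (n + 1)) t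
          (vandermondeLink f) =
        vandermondeLink
          (doobTransform (karlinMcGregor DTilde n) vdm (vdmEigenvalue a (b + 2 * a) b' n) t f) := by
  have hlamTilde' : lamTilde = quadRate a (b + 2 * a) (a + b + c) := by
    rw [hlamTilde, hlam]
    funext x
    simp only [quadRate]
    push_cast
    ring
  have hsucc : ∀ x ∈ I, x + 1 ∈ I := by
    rcases hdeath with ⟨rfl, -⟩ | ⟨rfl, -⟩
    · intro x hx
      simp only [Set.mem_Ici] at hx ⊢
      omega
    · exact fun x _ => Set.mem_univ _
  have hpred : ∀ x ∈ I, mu x ≠ 0 → x - 1 ∈ I := by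
    rcases hdeath with ⟨rfl, h0, -⟩ | ⟨rfl, -⟩
    · intro x hx hmux
      have : x ≠ 0 := fun h => hmux (h ▸ h0)
      simp only [Set.mem_Ici] at hx ⊢
      omega
    · exact fun x _ _ => Set.mem_univ _
  have hmu0 : ∀ x ∈ I, 0 ≤ mu x := by
    rcases hdeath with ⟨rfl, h0, h⟩ | ⟨rfl, h⟩
    · intro x hx
      by_cases hx0 : x = 0
      · rw [hx0, h0]
      · exact (h x hx hx0).le
    · exact fun x hx => (h x hx).le
  have hP : PolyBirthDeath I lam mu := by
    subst hlam hmu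
    exact polyBirthDeath_quadRate hsucc hpred (fun x hx => (hbirth x hx).le) hmu0
  have hS : PolyBirthDeath I lamTilde mu := by
    have h : ∀ x ∈ I, 0 ≤ lamTilde x := fun x hx => by
      rw [hlamTilde]
      exact (hbirth _ (hsucc x hx)).le
    rw [hlamTilde', hmu] at *
    exact polyBirthDeath_quadRate hsucc hpred h hmu0
  have hlamS : ∀ x, lamTilde x = lam (x + 1) := fun x => by rw [hlamTilde]
  have hr : ∀ x, lam (x + 1) - lam x - mu (x + 1) + mu x = b - b' := by
    intro x
    rw [hlam, hmu]
    simp only [quadRate]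
    push_cast
    ring
  subst hD hDTilde
  refine ⟨⟨vdm_pos, fun t ht x => ?_⟩, ⟨vdm_pos, fun t ht x => ?_⟩, fun f t ht => ?_⟩
  · subst hlam hmu
    exact hasSum_karlinMcGregor_mul_vdm hP ht x
  · subst hlamTilde' hmu
    exact hasSum_karlinMcGregor_mul_vdm hS ht x
  -- Boundedness of `f` suffices: `Δ_n f` then has polynomial growth.
  · obtain ⟨B, hB⟩ : ∃ B, ∀ y, |f y| ≤ B := by
      obtain ⟨B, hB⟩ := (ZeroAtInftyContinuousMap.isBounded_range f).exists_norm_le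
      exact ⟨B, fun y => hB _ (Set.mem_range_self y)⟩
    have hg : PolyGrowth fun y : WeylChamber I n => vdm y * f y := polyGrowth_vdm.mul_bounded hB
    have hlink : ∀ x' : WeylChamber I (n + 1), vdm x' * vandermondeLink f x' =
        n.factorial * interlacingSum (fun y => vdm y * f y) x' := by
      intro x'
      rw [vandermondeLink, interlacingSum, ← mul_assoc, mul_div_cancel₀ _ (vdm_pos x').ne']
    have hlinkG : PolyGrowth (interlacingSum fun y : WeylChamber I n => vdm y * f y) := by
      obtain ⟨N, M, hM⟩ := hg.interlacingSum
      refine ⟨N, M, fun x => le_trans ?_ ((le_abs_self _).trans (hM x))⟩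
      have hs : Summable fun y : {y : WeylChamber I n // Interlaces x y} => ‖vdm y.1 * f y.1‖ :=
        Summable.of_finite
      exact norm_tsum_le_tsum_norm hs
    refine ⟨fun x => ?_, fun x => summable_karlinMcGregor_mul' hS ht x hg, ?_⟩
    · simp only [hlink, mul_left_comm _ (n.factorial : ℝ)]
      exact (summable_karlinMcGregor_mul' hP ht x hlinkG).mul_left _
    · funext x
      have hinner : ∀ y : WeylChamber I n, vdm y * doobTransform
          (karlinMcGregor (birthDeathMatrix I lamTilde mu) n) vdm
          (vdmEigenvalue a (b + 2 * a) b' n) t f y =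
          Real.exp (-vdmEigenvalue a (b + 2 * a) b' n * t) *
            ∑' z, karlinMcGregor (birthDeathMatrix I lamTilde mu) n t y z * (vdm z * f z) := by
        intro y
        have := (vdm_pos y).ne'
        rw [doobTransform]
        field_simp
      rw [doobTransform, vandermondeLink]
      simp only [hlink, hinner, mul_left_comm _ (n.factorial : ℝ), tsum_mul_left]
      -- The factor `e^{(b - b') n t}` of the intertwining is exactly the quotient of the two
      -- eigenvalues and cancels.
      rw [tsum_karlinMcGregor_mul_interlacingSum hP hS hlamS hr ht hg, vdmEigenvalue_succ,
        interlacingSum, show -(vdmEigenvalue a (b + 2 * a) b' n + (b - b') * n) * t =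
          -vdmEigenvalue a (b + 2 * a) b' n * t - (b - b') * n * t by ring, Real.exp_sub]
      have := (Real.exp_pos ((b - b') * n * t)).ne'
      field_simp
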